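/- An altruistic coalition formation game (ACFG) is given by a set $N=\{1,\dots,n\}$ of agents, a network of friends, i.e., a simple undirected graph $G$ on $N$, and one of six kinds: sum-based or min-based, combined with selfish first (SF), equal treatment (EQ) or altruistic treatment (AL). For $i\in N$ let $F_i$ be the set of neighbours of $i$ in $G$ and $E_i=N\setminus(F_i\cup\{i\})$. A coalition structure is a partition $\Gamma$ of $N$; $\Gamma(i)$ is the block containing $i$, and $v_i(\Gamma)=n\,|\Gamma(i)\cap F_i|-|\Gamma(i)\cap E_i|$. For a set $S\subseteq N$ let $a_S(\Gamma)=\sum_{f\in S}v_f(\Gamma)$ if the game is sum-based and $a_S(\Gamma)=\min_{f\in S}v_f(\Gamma)$ if it is min-based, where $\min\emptyset=0$. With a constant $M\ge n^3$ (which may depend on the game), the utility of agent $i$ is $$u_i(\Gamma)=\begin{cases}M\,v_i(\Gamma)+a_{F_i}(\Gamma)&\text{(SF)},\\ a_{F_i\cup\{i\}}(\Gamma)&\text{(EQ)},\\ v_i(\Gamma)+M\,a_{F_i}(\Gamma)&\text{(AL)}.\end{cases}$$ Agent $i$ weakly prefers $\Gamma$ to $\Delta$ if $u_i(\Gamma)\ge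 u_i(\Delta)$. A coalition structure $\Gamma$ is perfect if every agent weakly prefers $\Gamma$ to every coalition structure $\Delta$ of $N$. In the problems below a game is given by its kind and the adjacency matrix of $G$, and a coalition structure by the characteristic vectors of the coalitions $\Gamma(i)$, $i \in N$. **Proposition.** (1) For any ACFGs (that is, for each of the six kinds of ACFGs, and also for any set of these kinds allowed together as input), the problem perfectness verification, "given an ACFG and a coalition structure $\Gamma$, is $\Gamma$ perfect?", is in $\mathrm{coNP}$. (2) For sum-based EQ ACFGs, the problem perfectness existence, "given an ACFG, does there exist a perfect coalition structure?", is in $\mathrm{coNP}$. -/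

import Mathlib

/-! ### Complexity classes

Polynomial time is Mathlib's notion: computability by a multi-stack Turing machine within a number
of steps that is polynomial in the length of the input. -/

/-- A language `L` over a finite alphabet `A` is in NP: there are a polynomial `q` and a
deterministic polynomial-time verifier `V` such that `x ∈ L` iff some certificate `w` (a word over
a finite alphabet `B`) of length at most `q(|x|)` is accepted by `V` together with `x`.  The pair
`(x, w)` is handed to the machine as the word `x` followed by the word `w`, over the disjoint union
of the alphabets. -/
def InNP {A : Type} [Fintype A] (L : Language A) : Prop :=
  ∃ (B : Type) (_ : Fintype B) (q : Polynomial ℕ) (V : List A × List B → Bool),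
    Nonempty (Turing.TM2ComputableInPolyTime
      (Computability.encodingProd (Computability.encodingList A)
        (Computability.encodingList B)).encode
      Computability.encodeBool V) ∧
    ∀ x : List A, x ∈ L ↔ ∃ w : List B, w.length ≤ q.eval x.length ∧ V (x, w) = true

/-- A language is in coNP if its complement (in the set of all words) is in NP. -/
def InCoNP {A : Type} [Fintype A] (L : Language A) : Prop :=
  InNP ({x : List A | x ∉ L} : Language A)

/-! ### Altruistic coalition formation games -/

/-- How the valuations of the friends are aggregated. -/
inductive Aggregation
  | sumBased
  | minBased
  deriving DecidableEq

instance : Fintype Aggregation :=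
  ⟨{.sumBased, .minBased}, fun a => by cases a <;> decide⟩

/-- The three degrees of altruism. -/
inductive Altruism
  | selfishFirst
  | equalTreatment
  | altruisticTreatment
  deriving DecidableEq

instance : Fintype Altruism :=
  ⟨{.selfishFirst, .equalTreatment, .altruisticTreatment}, fun d => by cases d <;> decide⟩

/-- An altruistic coalition formation game, given by the set `Fin n` of agents, the network of
friends (a simple undirected graph on the agents), and the way the preferences are obtained. -/
structure ACFG where
  /-- the number of agents -/
  n : ℕ
  /-- the network of friends -/
  network : SimpleGraph (Fin n)
  /-- sum-based or min-based aggregation -/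
  aggregation : Aggregation
  /-- the degree of altruism -/
  altruism : Altruism

namespace ACFG

/-- Coalition structures: partitions of the set of all agents.  For `Γ : g.CoalitionStructure`,
the coalition of agent `i` is `Γ.part i`. -/
abbrev CoalitionStructure (g : ACFG) : Type :=
  Finpartition (Finset.univ : Finset (Fin g.n))

noncomputable section

open scoped Classical in
/-- The set of friends of agent `i`. -/
def friends (g : ACFG) (i : Fin g.n) : Finset (Fin g.n) :=
  Finset.univ.filter fun j => g.network.Adj i j

/-- The set of enemies of agent `i`. -/
def enemies (g : ACFG) (i : Fin g.n) : Finset (Fin g.n) :=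
  Finset.univ \ (g.friends i ∪ {i})

/-- The value `n |Γ(i) ∩ F_i| - |Γ(i) ∩ E_i|` of agent `i` for the coalition structure `Γ`. -/
def value (g : ACFG) (Γ : g.CoalitionStructure) (i : Fin g.n) : ℤ :=
  (g.n : ℤ) * ((Γ.part i ∩ g.friends i).card : ℤ) - ((Γ.part i ∩ g.enemies i).card : ℤ)

/-- The aggregated value that the agents in `S` assign to `Γ`: the sum or the minimum of their
values; the minimum over the empty set is zero. -/
def aggregate (g : ACFG) (Γ : g.CoalitionStructure) (S : Finset (Fin g.n)) : ℤ :=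
  match g.aggregation with
  | .sumBased => ∑ f ∈ S, g.value Γ f
  | .minBased => if h : S.Nonempty then S.inf' h (g.value Γ) else 0

/-- The utility of agent `i` for `Γ`, where `M` is the weight used in the selfish-first and
altruistic-treatment models. -/
def utility (g : ACFG) (M : ℝ) (i : Fin g.n) (Γ : g.CoalitionStructure) : ℝ :=
  match g.altruism with
  | .selfishFirst => M * (g.value Γ i : ℝ) + (g.aggregate Γ (g.friends i) : ℝ)
  | .equalTreatment => (g.aggregate Γ (g.friends i ∪ {i}) : ℝ)
  | .altruisticTreatment => (g.value Γ i : ℝ) + M * (g.aggregate Γ (g.friends i) : ℝ)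

/-- Agent `i` weakly prefers `Γ` to `Δ`. -/
def WeaklyPrefers (g : ACFG) (M : ℝ) (i : Fin g.n) (Γ Δ : g.CoalitionStructure) : Prop :=
  g.utility M i Γ ≥ g.utility M i Δ

/-- `Γ` is perfect: no agent prefers any coalition structure to `Γ`. -/
def IsPerfect (g : ACFG) (M : ℝ) (Γ : g.CoalitionStructure) : Prop :=
  ∀ (i : Fin g.n) (Δ : g.CoalitionStructure), g.WeaklyPrefers M i Γ Δ

/-! ### Encoding of instances -/

/-- The input alphabet. -/
inductive Symbol
  | kind (a : Aggregation) (d : Altruism)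
  | bit (b : Bool)
  | comma
  | sep
  deriving DecidableEq, Fintype

open scoped Classical in
/-- A binary relation on `Fin n`, written as its 0-1-matrix, row by row, with a comma at the end of
each row. -/
def encodeRel {n : ℕ} (R : Fin n → Fin n → Prop) : List Symbol :=
  (List.ofFn fun i => (List.ofFn fun j => Symbol.bit (decide (R i j))) ++ [Symbol.comma]).flatten

/-- A game is written as its kind followed by the adjacency matrix of its network of friends. -/
def encode (g : ACFG) : List Symbol :=
  Symbol.kind g.aggregation g.altruism :: encodeRel g.network.Adj

/-- A game with a coalition structure `Γ` is written as the word of the game, a separator, and the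
matrix whose `i`-th row is the characteristic vector of the coalition of agent `i`. -/
def encodeWith (g : ACFG) (Γ : g.CoalitionStructure) : List Symbol :=
  g.encode ++ Symbol.sep :: encodeRel fun i j => j ∈ Γ.part i

theorem length_encodeRel {n : ℕ} (R : Fin n → Fin n → Prop) :
    (encodeRel R).length = n * (n + 1) := by
  simp [encodeRel, List.length_flatten, List.map_ofFn, Function.comp_def]

theorem encodeRel_injective {n : ℕ} {R S : Fin n → Fin n → Prop}
    (h : encodeRel R = encodeRel S) : R = S := by
  have h' := List.eq_iff_flatten_eq.2
    ⟨h, by simp [List.map_ofFn, Function.comp_def]⟩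
  funext i j
  have h2 := congrFun (List.ofFn_injective h') i
  have h3 := congrFun (List.ofFn_injective (List.append_cancel_right h2)) j
  simpa using h3

/-- Different games are written as different words. -/
theorem encode_injective : Function.Injective encode := by
  rintro ⟨n, G, a, d⟩ ⟨m, H, b, e⟩ h
  have hl := congrArg List.length h
  simp only [encode, List.length_cons, length_encodeRel] at hl
  obtain rfl : n = m := by nlinarith
  simp only [encode, List.cons.injEq, Symbol.kind.injEq] at h
  obtain ⟨⟨rfl, rfl⟩, h⟩ := h
  have := SimpleGraph.ext (encodeRel_injective h)
  subst this
  rfl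

/-- Different pairs of a game and a coalition structure are written as different words. -/
theorem encodeWith_injective :
    Function.Injective fun p : (Σ g : ACFG, g.CoalitionStructure) => p.1.encodeWith p.2 := by
  rintro ⟨g, Γ⟩ ⟨g', Δ⟩ h
  have hl := congrArg List.length h
  simp only [encodeWith, encode, List.length_append, List.length_cons, length_encodeRel] at hl
  have hn : g.n = g'.n := by nlinarith
  have h1 := List.append_inj h (by simp [encode, length_encodeRel, hn])
  obtain rfl := encode_injective h1.1
  have h2 := encodeRel_injective (List.cons.inj h1.2).2
  have key : ∀ i, Γ.part i = Δ.part i := fun i => by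
    ext j
    exact iff_of_eq (congrFun (congrFun h2 i) j)
  have hp : Γ.parts = Δ.parts := by
    ext p
    constructor
    · intro hp
      obtain ⟨i, hi⟩ := Γ.nonempty_of_mem_parts hp
      rw [← Γ.part_eq_of_mem hp hi, key i]
      exact Δ.part_mem.2 (Finset.mem_univ i)
    · intro hp
      obtain ⟨i, hi⟩ := Δ.nonempty_of_mem_parts hp
      rw [← Δ.part_eq_of_mem hp hi, ← key i]
      exact Γ.part_mem.2 (Finset.mem_univ i)
  rw [Finpartition.ext hp]

/-! ### The decision problems

`T` is the class of kinds of games that are admitted as input (for instance a single kind, or all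
six of them), and `M g` is the weight used in the game `g`. -/

/-- Perfectness verification: given a game and a coalition structure `Γ`, is `Γ` perfect? -/
def perfectnessVerification (M : ACFG → ℝ) (T : Set (Aggregation × Altruism)) :
    Language Symbol :=
  {x | ∃ (g : ACFG) (Γ : g.CoalitionStructure),
    (g.aggregation, g.altruism) ∈ T ∧ x = g.encodeWith Γ ∧ g.IsPerfect (M g) Γ}

/-- Perfectness existence: given a game, does it have a perfect coalition structure? -/
def perfectnessExistence (M : ACFG → ℝ) (T : Set (Aggregation × Altruism)) :
    Language Symbol :=
  {x | ∃ g : ACFG, (g.aggregation, g.altruism) ∈ T ∧ x = g.encode ∧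
    ∃ Γ : g.CoalitionStructure, g.IsPerfect (M g) Γ}

end

end ACFG

/-! A structure fails to be perfect exactly when some agent strictly prefers another structure, and
the matrix of that other structure is a certificate of n² bits. Two points need an argument:
preferences must be decidable in polynomial time although the weight is an arbitrary real number,
and existence must be reduced to verification.

The weight disappears because value differences and aggregate differences are integers of absolute
value below n³ ≤ M. The weighted sums therefore compare lexicographically (`lexicographic`), and
`improves_iff` expresses a strict preference through natural numbers bounded by a polynomial.

In the sum-based equal treatment model a perfect structure is determined by the network: two agents
share a block iff their distance is at most two (`IsPerfect.mem_part_iff`). Friends must share a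
block, since otherwise merging two blocks or moving one agent benefits somebody
(`FibresPerfect.eq_of_adj`). Members of a block without a common friend must be equal or friends,
since otherwise isolating one of them benefits the other (`FibresPerfect.exists_path`). Existence
thus asks whether one explicit candidate is a partition and perfect. Both problems are instances of
`inCoNP_of_definable`.

Polynomial time is obtained from a small language of functions, `Definable`: arithmetic, comparison,
symbol tests and sums over the positions of a word. Its functions have polynomially bounded values,
so unary counters suffice. Each one is compiled to a structured program whose variables are heads on
copies of the word (`Definable.bounded_and_addable`), and the program is turned into a Turing
machine (`polyTime_of_definable`). It remains to write the verifier as a definable property. -/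

/-! ### Structured programs over stacks -/

/-- Structured programs over a family of stacks with a finite internal state. -/
inductive StackProg {K : Type} (Γ : K → Type) (σ : Type)
  | skip
  | push (k : K) (f : σ → Γ k)
  | pop (k : K) (f : σ → Option (Γ k) → σ)
  | peek (k : K) (f : σ → Option (Γ k) → σ)
  | seq (a b : StackProg Γ σ)
  | ite (p : σ → Bool) (a b : StackProg Γ σ)
  | loop (p : σ → Bool) (a : StackProg Γ σ)

namespace StackProg

open Turing Function

variable {K : Type} {Γ : K → Type} {σ : Type}

/-- The program points of a program. -/
def Label : StackProg Γ σ → Type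
  | skip => Unit
  | push _ _ => Unit
  | pop _ _ => Unit
  | peek _ _ => Unit
  | seq a b => Label a ⊕ Label b
  | ite _ a b => Option (Label a ⊕ Label b)
  | loop _ a => Option (Label a)

/-- A program has finitely many program points. -/
@[reducible]
def labelFintype : (c : StackProg Γ σ) → Fintype (Label c)
  | skip => inferInstanceAs (Fintype Unit)
  | push _ _ => inferInstanceAs (Fintype Unit)
  | pop _ _ => inferInstanceAs (Fintype Unit)
  | peek _ _ => inferInstanceAs (Fintype Unit)
  | seq a b =>
    letI := labelFintype a
    letI := labelFintype b
    inferInstanceAs (Fintype (Label a ⊕ Label b))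
  | ite _ a b =>
    letI := labelFintype a
    letI := labelFintype b
    inferInstanceAs (Fintype (Option (Label a ⊕ Label b)))
  | loop _ a =>
    letI := labelFintype a
    inferInstanceAs (Fintype (Option (Label a)))

/-- The program point at which the execution starts. -/
def entry : (c : StackProg Γ σ) → Label c
  | skip => ()
  | push _ _ => ()
  | pop _ _ => ()
  | peek _ _ => ()
  | seq a _ => Sum.inl (entry a)
  | ite _ _ _ => none
  | loop _ _ => none

/-- The translation of a program into statements of a multi-stack Turing machine with labels `Λ`,
where `emb` embeds the program points and `ex` is the label to be reached at the end. -/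
def code {Λ : Type} : (c : StackProg Γ σ) → (Label c → Λ) → Λ → Label c → TM2.Stmt Γ Λ σ
  | skip, _, ex, _ => .goto fun _ => ex
  | push k f, _, ex, _ => .push k f (.goto fun _ => ex)
  | pop k f, _, ex, _ => .pop k f (.goto fun _ => ex)
  | peek k f, _, ex, _ => .peek k f (.goto fun _ => ex)
  | seq a b, emb, _, .inl l =>
    code a (fun l => emb (Sum.inl l)) (emb (Sum.inr (entry b))) l
  | seq _ b, emb, ex, .inr l => code b (fun l => emb (Sum.inr l)) ex l
  | ite p a b, emb, _, none =>
    .branch p (.goto fun _ => emb (some (Sum.inl (entry a))))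
      (.goto fun _ => emb (some (Sum.inr (entry b))))
  | ite _ a _, emb, ex, some (.inl l) => code a (fun l => emb (some (Sum.inl l))) ex l
  | ite _ _ b, emb, ex, some (.inr l) => code b (fun l => emb (some (Sum.inr l))) ex l
  | loop p a, emb, ex, none =>
    .branch p (.goto fun _ => emb (some (entry a))) (.goto fun _ => ex)
  | loop _ a, emb, _, some l => code a (fun l => emb (some l)) (emb none) l

variable [DecidableEq K]

/-- `Exec c v S v' S' t`: the program `c`, started with internal state `v` and stacks `S`, ends with
`v'` and `S'` after `t` steps. -/
inductive Exec : StackProg Γ σ → σ → (∀ k, List (Γ k)) → σ → (∀ k, List (Γ k)) → ℕ → Prop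
  | skip (v S) : Exec skip v S v S 1
  | push (k f v S) : Exec (push k f) v S v (update S k (f v :: S k)) 1
  | pop (k f v S) : Exec (pop k f) v S (f v (S k).head?) (update S k (S k).tail) 1
  | peek (k f v S) : Exec (peek k f) v S (f v (S k).head?) S 1
  | seq {a b v S v₁ S₁ v₂ S₂ t₁ t₂} : Exec a v S v₁ S₁ t₁ → Exec b v₁ S₁ v₂ S₂ t₂ →
      Exec (seq a b) v S v₂ S₂ (t₁ + t₂)
  | ite_true {p a b v S v₁ S₁ t} : p v = true → Exec a v S v₁ S₁ t →
      Exec (ite p a b) v S v₁ S₁ (1 + t)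
  | ite_false {p a b v S v₁ S₁ t} : p v = false → Exec b v S v₁ S₁ t →
      Exec (ite p a b) v S v₁ S₁ (1 + t)
  | loop_true {p a v S v₁ S₁ v₂ S₂ t₁ t₂} : p v = true → Exec a v S v₁ S₁ t₁ →
      Exec (loop p a) v₁ S₁ v₂ S₂ t₂ → Exec (loop p a) v S v₂ S₂ (1 + t₁ + t₂)
  | loop_false {p a v S} : p v = false → Exec (loop p a) v S v S 1

/-- The machine `m` gets from one configuration to another one in exactly `t` steps. -/
def ReachesIn {Λ : Type} (m : Λ → TM2.Stmt Γ Λ σ) (t : ℕ) (c c' : TM2.Cfg Γ Λ σ) : Prop :=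
  (flip bind (TM2.step m))^[t] (some c) = some c'

theorem ReachesIn.trans {Λ : Type} {m : Λ → TM2.Stmt Γ Λ σ} {s t : ℕ} {a b c : TM2.Cfg Γ Λ σ}
    (h₁ : ReachesIn m s a b) (h₂ : ReachesIn m t b c) : ReachesIn m (s + t) a c := by
  unfold ReachesIn at *
  rw [add_comm, iterate_add_apply, h₁, h₂]

theorem ReachesIn.single {Λ : Type} {m : Λ → TM2.Stmt Γ Λ σ} {l : Λ} {v : σ}
    {S : ∀ k, List (Γ k)} {s : TM2.Stmt Γ Λ σ} (h : m l = s) :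
    ReachesIn m 1 ⟨some l, v, S⟩ (TM2.stepAux s v S) := by
  subst h; rfl

/-- A machine that contains the translation of a program simulates the program. -/
theorem Exec.reachesIn {Λ : Type} {m : Λ → TM2.Stmt Γ Λ σ} {c : StackProg Γ σ} {v v' : σ}
    {S S' : ∀ k, List (Γ k)} {t : ℕ} (h : Exec c v S v' S' t) (emb : Label c → Λ) (ex : Λ)
    (hm : ∀ l, m (emb l) = code c emb ex l) :
    ReachesIn m t ⟨some (emb (entry c)), v, S⟩ ⟨some ex, v', S'⟩ := by
  induction h generalizing ex with
  | skip | push | pop | peek => exact ReachesIn.single (hm ())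
  | seq _ _ iha ihb =>
    exact (iha (fun l => emb (Sum.inl l)) _ fun l => hm (Sum.inl l)).trans
      (ihb (fun l => emb (Sum.inr l)) _ fun l => hm (Sum.inr l))
  | ite_true hp _ ih =>
    refine ReachesIn.trans (ReachesIn.single (hm none)) ?_
    simp only [code, TM2.stepAux, hp, cond_true]
    exact ih (fun l => emb (some (Sum.inl l))) _ fun l => hm (some (Sum.inl l))
  | ite_false hp _ ih =>
    refine ReachesIn.trans (ReachesIn.single (hm none)) ?_
    simp only [code, TM2.stepAux, hp, cond_false]
    exact ih (fun l => emb (some (Sum.inr l))) _ fun l => hm (some (Sum.inr l))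
  | loop_true hp _ _ iha ihl =>
    refine ReachesIn.trans (ReachesIn.trans (ReachesIn.single (hm none)) ?_) (ihl emb ex hm)
    simp only [code, TM2.stepAux, hp, cond_true]
    exact iha (fun l => emb (some l)) _ fun l => hm (some l)
  | loop_false hp =>
    have := ReachesIn.single (v := ‹σ›) (S := ‹_›) (hm none)
    simp only [code, TM2.stepAux, hp, cond_false] at this
    exact this

/-- `c` gets from `(v, S)` to `(v', S')` in at most `T` steps. -/
def Runs (c : StackProg Γ σ) (v : σ) (S : ∀ k, List (Γ k)) (v' : σ) (S' : ∀ k, List (Γ k))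
    (T : ℕ) : Prop :=
  ∃ t ≤ T, Exec c v S v' S' t

variable {a b c : StackProg Γ σ} {v v' v₁ v₂ : σ} {S S' S₁ S₂ : ∀ k, List (Γ k)} {T T' T₁ T₂ : ℕ}

theorem Exec.runs {t : ℕ} (h : Exec c v S v' S' t) : Runs c v S v' S' t := ⟨t, le_rfl, h⟩

theorem Runs.mono (h : Runs c v S v' S' T) (hT : T ≤ T') : Runs c v S v' S' T' :=
  let ⟨t, ht, hx⟩ := h
  ⟨t, ht.trans hT, hx⟩

theorem Runs.seq (h₁ : Runs a v S v₁ S₁ T₁) (h₂ : Runs b v₁ S₁ v₂ S₂ T₂) :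
    Runs (seq a b) v S v₂ S₂ (T₁ + T₂) :=
  let ⟨_, ht₁, hx₁⟩ := h₁
  let ⟨_, ht₂, hx₂⟩ := h₂
  ⟨_, Nat.add_le_add ht₁ ht₂, hx₁.seq hx₂⟩

theorem Runs.ite {p : σ → Bool} (h₁ : p v = true → Runs a v S v' S' T)
    (h₂ : p v = false → Runs b v S v' S' T) : Runs (ite p a b) v S v' S' (1 + T) := by
  cases hp : p v with
  | true =>
    obtain ⟨t, ht, hx⟩ := h₁ hp
    exact ⟨_, Nat.add_le_add_left ht 1, .ite_true hp hx⟩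
  | false =>
    obtain ⟨t, ht, hx⟩ := h₂ hp
    exact ⟨_, Nat.add_le_add_left ht 1, .ite_false hp hx⟩

/-- A loop that is left after exactly `n` iterations, when `p` holds initially iff `0 < n`. -/
theorem Runs.loop {p : σ → Bool} (n : ℕ) (Z : ℕ → ∀ k, List (Γ k)) (hv : p v = decide (0 < n))
    (h : ∀ j < n, ∀ v, ∃ v', p v' = decide (j + 1 < n) ∧ Runs a v (Z j) v' (Z (j + 1)) T) :
    ∃ v', Runs (loop p a) v (Z 0) v' (Z n) (n * (1 + T) + 1) := by
  induction n generalizing v Z with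
  | zero => exact ⟨v, 1, by omega, .loop_false (by simpa using hv)⟩
  | succ n ih =>
    obtain ⟨v₁, hv₁, t₁, ht₁, hx₁⟩ := h 0 n.succ_pos v
    obtain ⟨v₂, t₂, ht₂, hx₂⟩ := ih (v := v₁) (fun j => Z (j + 1)) (by simpa using hv₁)
      fun j hj v => by simpa using h (j + 1) (by omega) v
    exact ⟨v₂, _, by rw [Nat.succ_mul]; omega, .loop_true (by simpa using hv) hx₁ hx₂⟩

end StackProg

/-! ### Zippers over the input word and unary counters. -/

namespace StackProg

set_option linter.unusedVariables false

open Turing Function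

/-- The stacks of the verifiers: the input, the output, `D` zippers that hold copies of the input
word, and `D` unary counters. -/
inductive Key (D : ℕ)
  | input
  | output
  | left (k : Fin D)
  | right (k : Fin D)
  | counter (k : Fin D)
  deriving DecidableEq, Fintype

/-- The alphabets of the stacks of the verifiers. -/
abbrev Alphabet (Γ : Type) (D : ℕ) : Key D → Type
  | .input => Γ
  | .output => Bool
  | .left _ => Option Γ
  | .right _ => Option Γ
  | .counter _ => Option Γ

/-- The verifiers: structured programs whose internal state is the symbol popped or peeked last. -/
abbrev Verifier (Γ : Type) (D : ℕ) : Type := StackProg (Alphabet Γ D) (Option (Option Γ))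

variable {Γ : Type} {D : ℕ}

/-- The stacks with given contents. -/
def layout (i : List Γ) (o : List Bool) (L R C : ℕ → List (Option Γ)) :
    ∀ k : Key D, List (Alphabet Γ D k)
  | .input => i
  | .output => o
  | .left k => L k
  | .right k => R k
  | .counter k => C k

variable {i : List Γ} {o : List Bool} {L R C : ℕ → List (Option Γ)}

/-- The families are indexed by all natural numbers to avoid `Fin` arithmetic; their entries from
`D` on describe no stack. -/
theorem layout_congr {L' R' C' : ℕ → List (Option Γ)} (hL : ∀ k < D, L k = L' k)
    (hR : ∀ k < D, R k = R' k) (hC : ∀ k < D, C k = C' k) :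
    (layout i o L R C : ∀ k : Key D, _) = layout i o L' R' C' := by
  funext k
  cases k with
  | input | output => rfl
  | left k => exact hL k k.2
  | right k => exact hR k k.2
  | counter k => exact hC k k.2

theorem update_input (x : List Γ) :
    update (layout i o L R C : ∀ k : Key D, _) .input x = layout x o L R C := by
  funext j
  cases j <;> simp [layout, update]

theorem update_output (x : List Bool) :
    update (layout i o L R C : ∀ k : Key D, _) .output x = layout i x L R C := by
  funext j
  cases j <;> simp [layout, update]

theorem update_left (k : Fin D) (x : List (Option Γ)) :
    update (layout i o L R C : ∀ k : Key D, _) (.left k) x =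
      layout i o (update L k x) R C := by
  funext j
  rcases eq_or_ne j (.left k) with rfl | hj
  · simp [layout]
  · rw [update_of_ne hj]
    cases j <;> simp_all [layout, update, Fin.ext_iff]

theorem update_right (k : Fin D) (x : List (Option Γ)) :
    update (layout i o L R C : ∀ k : Key D, _) (.right k) x =
      layout i o L (update R k x) C := by
  funext j
  rcases eq_or_ne j (.right k) with rfl | hj
  · simp [layout]
  · rw [update_of_ne hj]
    cases j <;> simp_all [layout, update, Fin.ext_iff]

theorem update_counter (k : Fin D) (x : List (Option Γ)) :
    update (layout i o L R C : ∀ k : Key D, _) (.counter k) x =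
      layout i o L R (update C k x) := by
  funext j
  rcases eq_or_ne j (.counter k) with rfl | hj
  · simp [layout]
  · rw [update_of_ne hj]
    cases j <;> simp_all [layout, update, Fin.ext_iff]

/-- The stacks while the zippers hold `W` and are at the positions `p`, and the counters have the
values `n`. -/
def config (D : ℕ) (W : List Γ) (p n : ℕ → ℕ) : ∀ k : Key D, List (Alphabet Γ D k) :=
  layout [] [] (fun k => ((W.take (p k)).reverse).map some) (fun k => (W.drop (p k)).map some)
    fun k => List.replicate (n k) none

variable {W : List Γ} {p n : ℕ → ℕ}

/-- Increase a counter. -/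
def inc (k : Fin D) : Verifier Γ D := .push (.counter k) fun _ => none

/-- Decrease a counter if it is positive, and remember whether it was. -/
def dec (k : Fin D) : Verifier Γ D := .pop (.counter k) fun _ s => s

/-- Look at the current symbol of a zipper. -/
def look (k : Fin D) : Verifier Γ D := .peek (.right k) fun _ s => s

/-- Move one step to the right. -/
def moveRight (k : Fin D) : Verifier Γ D :=
  .seq (.pop (.right k) fun _ s => s) (.push (.left k) fun v => v.getD none)

/-- Move one step to the left if possible, and remember whether it was. -/
def moveLeft (k : Fin D) : Verifier Γ D :=
  .seq (.pop (.left k) fun _ s => s)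
    (.ite (fun v => v.isSome) (.push (.right k) fun v => v.getD none) .skip)

theorem right_ne_left (k : Fin D) : Key.right k ≠ Key.left k := nofun

theorem config_left (k : Fin D) :
    config D W p n (.left k) = ((W.take (p k)).reverse).map some := rfl

theorem config_right (k : Fin D) : config D W p n (.right k) = (W.drop (p k)).map some := rfl

theorem config_counter (k : Fin D) :
    config D W p n (.counter k) = List.replicate (n k) none := rfl

theorem update_config_counter (k : Fin D) (m : ℕ) :
    update (config D W p n) (.counter k) (List.replicate m none) =
      config D W p (update n k m) := by
  unfold config
  rw [update_counter]
  congr 1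
  funext j
  rcases eq_or_ne j k with rfl | hj
  · simp
  · simp [hj]

theorem update_config_zipper (k : Fin D) (m : ℕ) :
    update (update (config D W p n) (.right k) ((W.drop m).map some)) (.left k)
      (((W.take m).reverse).map some) = config D W (update p k m) n := by
  unfold config
  rw [update_right, update_left]
  refine layout_congr (fun j _ => ?_) (fun j _ => ?_) fun _ _ => rfl <;>
  · rcases eq_or_ne j k with rfl | hj
    · rw [update_self, update_self]
    · rw [update_of_ne hj, update_of_ne hj]

variable {p' n' : ℕ → ℕ} {k : ℕ}

/-- The new counters enter through an equation, so that each use can present them in the form its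
loop invariant requires; the other basic moves follow the same pattern. -/
theorem inc_runs (hk : k < D) (v) (h : n' = update n k (n k + 1)) :
    Runs (inc ⟨k, hk⟩) v (config D W p n) v (config D W p n') 1 := by
  subst h
  rw [← update_config_counter ⟨k, hk⟩]
  exact (Exec.push ..).runs

/-- The final state reports the value before the decrement, which is what a loop tests. Truncated
subtraction agrees with popping an empty stack. -/
theorem dec_runs (hk : k < D) (v) (h : n' = update n k (n k - 1)) :
    ∃ v', v'.isSome = decide (0 < n k) ∧
      Runs (dec ⟨k, hk⟩) v (config D W p n) v' (config D W p n') 1 := by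
  subst h
  have h := (Exec.pop (Γ := Alphabet Γ D) (σ := Option (Option Γ)) (Key.counter ⟨k, hk⟩)
    (fun _ s => s) v (config D W p n)).runs
  rw [config_counter, List.tail_replicate, update_config_counter] at h
  refine ⟨_, ?_, h⟩
  rcases hn : n k with _ | m <;> simp [List.replicate_succ]

theorem look_runs (hk : k < D) (v) :
    Runs (look ⟨k, hk⟩) v (config D W p n) (W[p k]?.map some) (config D W p n) 1 := by
  have h := (Exec.peek (Γ := Alphabet Γ D) (σ := Option (Option Γ)) (Key.right ⟨k, hk⟩)
    (fun _ s => s) v (config D W p n)).runs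
  rw [config_right, List.head?_map, List.head?_drop] at h
  exact h

theorem moveRight_runs (hD : k < D) (v) (hk : p k < W.length) (h : p' = update p k (p k + 1)) :
    ∃ v', Runs (moveRight ⟨k, hD⟩) v (config D W p n) v' (config D W p' n) 2 := by
  subst h
  have h₁ := (Exec.pop (Γ := Alphabet Γ D) (σ := Option (Option Γ)) (Key.right ⟨k, hD⟩)
    (fun _ s => s) v (config D W p n)).runs
  have h₂ := (Exec.push (Γ := Alphabet Γ D) (σ := Option (Option Γ)) (Key.left ⟨k, hD⟩)
    (fun v => v.getD none) (some (some W[p k]))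
    (update (config D W p n) (.right ⟨k, hD⟩) (config D W p n (.right ⟨k, hD⟩)).tail)).runs
  rw [config_right, List.head?_map, List.head?_drop, List.getElem?_eq_getElem hk,
    ← List.map_tail, List.tail_drop] at h₁
  rw [config_right, ← List.map_tail, List.tail_drop,
    update_of_ne (right_ne_left ⟨k, hD⟩).symm, config_left] at h₂
  have h₃ : some W[p k] :: (W.take (p k)).reverse.map some =
      ((W.take (p k + 1)).reverse).map some := by
    rw [List.take_add_one, List.getElem?_eq_getElem hk, Option.toList_some, List.reverse_append,
      List.reverse_singleton, List.singleton_append, List.map_cons]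
  rw [← update_config_zipper ⟨k, hD⟩, ← h₃]
  exact ⟨_, h₁.seq h₂⟩

theorem moveLeft_runs (hD : k < D) (v) (hk : p k ≤ W.length) (h : p' = update p k (p k - 1)) :
    ∃ v', v'.isSome = decide (0 < p k) ∧
      Runs (moveLeft ⟨k, hD⟩) v (config D W p n) v' (config D W p' n) 3 := by
  subst h
  have h₁ := (Exec.pop (Γ := Alphabet Γ D) (σ := Option (Option Γ)) (Key.left ⟨k, hD⟩)
    (fun _ s => s) v (config D W p n)).runs
  rw [config_left] at h₁
  rcases Nat.eq_zero_or_pos (p k) with h0 | h0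
  -- At the left end the pop changes nothing, in accordance with truncated subtraction.
  · have he : update (config D W p n) (.left ⟨k, hD⟩) ((W.take (p k)).reverse.map some).tail =
        config D W (update p k (p k - 1)) n := by
      have : ((W.take (p k)).reverse.map some).tail = config D W p n (.left ⟨k, hD⟩) := by
        simp [config_left, h0]
      rw [this, update_eq_self, show p k - 1 = p k by omega, update_eq_self]
    rw [he] at h₁
    refine ⟨none, by simp [h0], ?_⟩
    refine Runs.seq (T₂ := 2) (v₁ := none) ?_ (Runs.ite (by simp) fun _ => (Exec.skip _ _).runs)
    simpa [h0] using h₁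
  · obtain ⟨q, hq⟩ := Nat.exists_eq_succ_of_ne_zero h0.ne'
    have hq' : q < W.length := by omega
    have hl : (W.take (p k)).reverse.map some = some W[q] :: (W.take q).reverse.map some := by
      rw [hq, Nat.succ_eq_add_one, List.take_add_one, List.getElem?_eq_getElem hq',
        Option.toList_some, List.reverse_append, List.reverse_singleton, List.singleton_append,
        List.map_cons]
    rw [hl, List.head?_cons, List.tail_cons] at h₁
    have h₂ := (Exec.push (Γ := Alphabet Γ D) (σ := Option (Option Γ)) (Key.right ⟨k, hD⟩)
      (fun v => v.getD none) (some (some W[q]))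
      (update (config D W p n) (.left ⟨k, hD⟩) ((W.take q).reverse.map some))).runs
    refine ⟨some (some W[q]), by simp [h0], ?_⟩
    refine Runs.seq (T₂ := 2) h₁ (Runs.ite (T := 1) (fun _ => ?_) nofun)
    rw [update_of_ne (right_ne_left ⟨k, hD⟩), config_right] at h₂
    have h₃ : some W[q] :: (W.drop (p k)).map some = (W.drop q).map some := by
      rw [hq, List.drop_eq_getElem_cons hq', List.map_cons]
    rw [← update_config_zipper ⟨k, hD⟩, update_comm (right_ne_left ⟨k, hD⟩),
      show p k - 1 = q by omega, ← h₃]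
    exact h₂

end StackProg

/-! ### A language of polynomially bounded functions. -/

open Function in
/-- The functions of a word `W` and of `d` variables, which stand for positions in `W`, that are
definable by means of arithmetic, comparisons, tests of symbols and sums over all positions. -/
inductive Definable {Γ : Type} : (d : ℕ) → (List Γ → (Fin d → ℕ) → ℕ) → Prop
  | const {d} (c : ℕ) : Definable d fun _ _ => c
  | var {d} (k : Fin d) : Definable d fun _ e => e k
  | symbol {d} (k : Fin d) (s : Γ → Bool) :
      Definable d fun W e => if W[e k]?.any s then 1 else 0
  | add {d f g} : Definable d f → Definable d g → Definable d fun W e => f W e + g W e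
  | mul {d f g} : Definable d f → Definable d g → Definable d fun W e => f W e * g W e
  | le {d f g} : Definable d f → Definable d g →
      Definable d fun W e => if f W e ≤ g W e then 1 else 0
  | sum {d f} : Definable (d + 1) f →
      Definable d fun W e => ∑ v ∈ Finset.range W.length, f W (Fin.snoc (α := fun _ => ℕ) e v)
  | congr {d f g} : Definable d f →
      (∀ W e, (∀ k, e k < W.length) → f W e = g W e) → Definable d g

/-! ### Compiling definable functions to programs. -/

namespace StackProg

open Function Polynomial

variable {Γ : Type} {D : ℕ}

/-- The positions of the zippers for given values of the variables. -/
def positions {d : ℕ} (e : Fin d → ℕ) (k : ℕ) : ℕ := if h : k < d then e ⟨k, h⟩ else 0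

theorem positions_fin {d : ℕ} (e : Fin d → ℕ) (k : Fin d) : positions e k = e k := by
  simp [positions]

theorem positions_snoc {d : ℕ} (e : Fin d → ℕ) (v : ℕ) :
    positions (Fin.snoc (α := fun _ => ℕ) e v) = update (positions e) d v := by
  funext k
  rcases lt_trichotomy k d with h | rfl | h
  · simp [positions, h, h.ne, Fin.snoc, show k < d + 1 by omega]
  · simp [positions, Fin.snoc]
  · simp [positions, h.ne', show ¬ k < d by omega, show ¬ k < d + 1 by omega]

/-- The program `P` adds the value of `f` to the counter `a` within time `T`, using the counters
from `m` on, which are zero before and after, for intermediate results. -/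
def Adds (P : Verifier Γ D) {d : ℕ} (f : List Γ → (Fin d → ℕ) → ℕ) (a m : ℕ) (T : ℕ[X]) : Prop :=
  ∀ W e n v, (∀ k, e k < W.length) → (∀ j ≥ m, n j = 0) →
    ∃ v', Runs P v (config D W (positions e) n) v'
      (config D W (positions e) (update n a (n a + f W e))) (T.eval W.length)

/-- There are programs that add the values of `f` to any counter in polynomial time. -/
def Addable {d : ℕ} (f : List Γ → (Fin d → ℕ) → ℕ) : Prop :=
  ∀ a m, a < m → ∃ h, ∀ D ≥ h, ∃ (P : Verifier Γ D) (T : ℕ[X]), Adds P f a m T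

theorem Runs.congr_config {c : Verifier Γ D} {v v' : Option (Option Γ)} {W : List Γ} {T : ℕ}
    {p n p' n' q m q' m' : ℕ → ℕ} (h : Runs c v (config D W p n) v' (config D W p' n') T)
    (hp : p = q) (hn : n = m) (hp' : p' = q') (hn' : n' = m') :
    Runs c v (config D W q m) v' (config D W q' m') T := by
  subst hp hn hp' hn'
  exact h

variable {d : ℕ} {f g : List Γ → (Fin d → ℕ) → ℕ}

theorem Addable.congr (hf : Addable f) (h : ∀ W e, (∀ k, e k < W.length) → f W e = g W e) :
    Addable g := by
  intro a m ham
  obtain ⟨h₁, H₁⟩ := hf a m ham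
  refine ⟨h₁, fun D hD => ?_⟩
  obtain ⟨P, T, hP⟩ := H₁ D hD
  refine ⟨P, T, fun W e n v he hn => ?_⟩
  rw [← h W e he]
  exact hP W e n v he hn

theorem Addable.add (hf : Addable f) (hg : Addable g) :
    Addable fun W e => f W e + g W e := by
  intro a m ham
  obtain ⟨h₁, H₁⟩ := hf a m ham
  obtain ⟨h₂, H₂⟩ := hg a m ham
  refine ⟨h₁ + h₂, fun D hD => ?_⟩
  obtain ⟨P₁, T₁, hP₁⟩ := H₁ D (by omega)
  obtain ⟨P₂, T₂, hP₂⟩ := H₂ D (by omega)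
  refine ⟨.seq P₁ P₂, T₁ + T₂, fun W e n v he hn => ?_⟩
  obtain ⟨v₁, r₁⟩ := hP₁ W e n v he hn
  obtain ⟨v₂, r₂⟩ := hP₂ W e (update n a (n a + f W e)) v₁ he fun j hj => by
    rw [update_of_ne (by omega), hn j hj]
  rw [update_self, update_idem, add_assoc] at r₂
  exact ⟨v₂, by simpa using r₁.seq r₂⟩

theorem Addable.one : Addable (fun _ _ => 1 : List Γ → (Fin d → ℕ) → ℕ) := fun a m ham =>
  ⟨m, fun D hD => ⟨inc ⟨a, ham.trans_le hD⟩, 1, fun W e n v _ _ => ⟨v, by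
    simpa using inc_runs (W := W) (p := positions e) (n := n) (ham.trans_le hD) v rfl⟩⟩⟩

theorem Addable.const (c : ℕ) : Addable (fun _ _ => c : List Γ → (Fin d → ℕ) → ℕ) := by
  induction c with
  | zero =>
    exact fun a m ham => ⟨0, fun D hD => ⟨.skip, 1, fun W e n v _ _ => ⟨v, by
      simpa using (Exec.skip v (config D W (positions e) n)).runs⟩⟩⟩
  | succ c ih => exact ih.add .one

theorem Addable.symbol (k : Fin d) (s : Γ → Bool) :
    Addable fun W (e : Fin d → ℕ) => if W[e k]?.any s then 1 else 0 := by
  intro a m ham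
  refine ⟨m + d, fun D hD => ?_⟩
  have hk : k < D := by omega
  have ha : a < D := by omega
  refine ⟨.seq (look ⟨k, hk⟩)
    (.ite (fun v => (v.bind id).any s) (inc ⟨a, ha⟩) .skip), 3, fun W e n v he hn => ?_⟩
  refine ⟨W[positions e k]?.map some, ((look_runs hk v).seq
    (Runs.ite (T := 1) (fun h => ?_) fun h => ?_)).mono
    (by norm_num)⟩
  · rw [positions_fin] at h ⊢
    have h' : (W[e k]?.any s) = true := by cases hx : W[e k]? <;> simp_all
    exact inc_runs ha _ (by simp only [if_pos h'])
  · rw [positions_fin] at h ⊢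
    have h' : ¬ (W[e k]?.any s) = true := by cases hx : W[e k]? <;> simp_all
    simp only [if_neg h', add_zero, update_eq_self]
    exact (Exec.skip _ _).runs

/-- The head walks to the left end while the target and a scratch counter are increased; the scratch
counter then brings the head back to its position. -/
theorem Addable.var (k : Fin d) : Addable fun (_ : List Γ) e => e k := by
  intro a m ham
  refine ⟨m + d + 1, fun D hD => ?_⟩
  have hK : k < D := by omega
  have hA : a < D := by omega
  have hM : m < D := by omega
  refine ⟨.seq (moveLeft ⟨k, hK⟩) (.seq (.loop (fun v => v.isSome) (.seq (inc ⟨a, hA⟩)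
    (.seq (inc ⟨m, hM⟩) (moveLeft ⟨k, hK⟩)))) (.seq (dec ⟨m, hM⟩)
    (.loop (fun v => v.isSome) (.seq (moveRight ⟨k, hK⟩) (dec ⟨m, hM⟩))))),
    X * 10 + 6, fun W e n v he hn => ?_⟩
  have hk := he k
  have hpk : positions e k = e k := positions_fin e k
  have hnm := hn m le_rfl
  obtain ⟨v₁, hv₁, r₁⟩ := moveLeft_runs (W := W) (n := n) (p := positions e) hK v (by omega) rfl
  -- A loop tests the outcome of the preceding move, so one move is made before it starts. The head
  -- is therefore one step ahead of the iteration count, and truncation absorbs the last step.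
  obtain ⟨v₂, r₂⟩ := Runs.loop (p := fun v => v.isSome) (v := v₁)
    (a := .seq (inc ⟨a, hA⟩) (.seq (inc ⟨m, hM⟩) (moveLeft ⟨k, hK⟩))) (T := 5) (e k)
    (fun j => config D W (update (positions e) k (e k - 1 - j))
      (update (update n a (n a + j)) m j)) (by rw [hv₁, hpk]) (by
        intro j hj v
        have i₁ := inc_runs (W := W) (p := update (positions e) k (e k - 1 - j)) hA v
          (n := update (update n a (n a + j)) m j) rfl
        have i₂ := inc_runs (W := W) (p := update (positions e) k (e k - 1 - j)) hM v
          (n := update (update (update n a (n a + j)) m j) a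
            (update (update n a (n a + j)) m j a + 1)) rfl
        obtain ⟨v', hv', i₃⟩ := moveLeft_runs (W := W)
          (p := update (positions e) k (e k - 1 - j))
          (n := update (update n a (n a + (j + 1))) m (j + 1))
          (p' := update (positions e) k (e k - 1 - (j + 1))) hK v (by simp; omega) (by
            funext i; simp only [update_apply]; split_ifs <;> omega)
        refine ⟨v', by rw [hv', update_self, decide_eq_decide]; omega,
          i₁.seq (T₂ := 4) (i₂.seq (T₂ := 3) ?_)⟩
        convert i₃ using 2
        funext i; simp only [update_apply]; split_ifs <;> omega)
  obtain ⟨v₃, hv₃, r₃⟩ := dec_runs (W := W) (p := update (positions e) k 0)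
    (n := update (update n a (n a + e k)) m (e k)) hM v₂ rfl
  obtain ⟨v₄, r₄⟩ := Runs.loop (p := fun v => v.isSome) (v := v₃)
    (a := .seq (moveRight ⟨k, hK⟩) (dec ⟨m, hM⟩)) (T := 3) (e k)
    (fun j => config D W (update (positions e) k j)
      (update (update n a (n a + e k)) m (e k - 1 - j))) (by rw [hv₃, update_self]) (by
        intro j hj v
        obtain ⟨v', i₁⟩ := moveRight_runs (W := W) (p := update (positions e) k j)
          (n := update (update n a (n a + e k)) m (e k - 1 - j))
          (p' := update (positions e) k (j + 1)) hK v (by simp; omega) (by simp)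
        obtain ⟨v'', hv'', i₂⟩ := dec_runs (W := W) (p := update (positions e) k (j + 1))
          (n := update (update n a (n a + e k)) m (e k - 1 - j))
          (n' := update (update n a (n a + e k)) m (e k - 1 - (j + 1))) hM v' (by
            funext i; simp only [update_apply]; split_ifs <;> omega)
        exact ⟨v'', by rw [hv'', update_self, decide_eq_decide]; omega, i₁.seq i₂⟩)
  refine ⟨v₄, ((r₁.seq (T₂ := e k * 10 + 5) ?_).mono ?_)⟩
  · refine (Runs.seq (T₁ := e k * 6 + 1) (T₂ := e k * 4 + 2) (r₂.congr_config ?_ ?_ ?_ rfl)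
      ((r₃.seq (r₄.congr_config ?_ ?_ ?_ ?_)).mono (by omega))).mono (by omega)
    · rw [hpk, Nat.sub_zero]
    · funext i; grind [update_apply]
    · rw [show e k - 1 - e k = 0 by omega]
    · rfl
    · funext i; grind [update_apply]
    · rw [← hpk, update_eq_self]
    · funext i; grind [update_apply]
  · simp; omega

/-- The first factor goes to the scratch counter `m`, and the program for the second factor is
repeated that many times. The bound on the first factor limits the number of iterations. -/
theorem Addable.mul (hf : Addable f) (hg : Addable g)
    (hB : ∃ B : ℕ[X], ∀ W e, (∀ k, e k < W.length) → f W e ≤ B.eval W.length) :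
    Addable fun W e => f W e * g W e := by
  intro a m ham
  obtain ⟨B, hB⟩ := hB
  obtain ⟨h₁, H₁⟩ := hf m (m + 1) (by omega)
  obtain ⟨h₂, H₂⟩ := hg a (m + 1) (by omega)
  refine ⟨h₁ + h₂ + m + 1, fun D hD => ?_⟩
  obtain ⟨P₁, T₁, hP₁⟩ := H₁ D (by omega)
  obtain ⟨P₂, T₂, hP₂⟩ := H₂ D (by omega)
  have hM : m < D := by omega
  refine ⟨.seq P₁ (.seq (dec ⟨m, hM⟩) (.loop (fun v => v.isSome) (.seq P₂ (dec ⟨m, hM⟩)))),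
    T₁ + (1 + (B * (1 + (T₂ + 1)) + 1)), fun W e n v he hn => ?_⟩
  have hnm := hn m le_rfl
  obtain ⟨v₁, r₁⟩ := hP₁ W e n v he fun j hj => hn j (by omega)
  rw [hnm, zero_add] at r₁
  obtain ⟨v₂, hv₂, r₂⟩ := dec_runs (W := W) (p := positions e) (n := update n m (f W e)) hM v₁ rfl
  obtain ⟨v₃, r₃⟩ := Runs.loop (p := fun v => v.isSome) (v := v₂)
    (a := .seq P₂ (dec ⟨m, hM⟩)) (T := T₂.eval W.length + 1) (f W e)
    (fun j => config D W (positions e)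
      (update (update n m (f W e - 1 - j)) a (n a + j * g W e))) (by rw [hv₂, update_self]) (by
        intro j hj v
        obtain ⟨v', i₁⟩ := hP₂ W e (update (update n m (f W e - 1 - j)) a (n a + j * g W e)) v he
          fun i hi => by
            rw [update_of_ne (by omega), update_of_ne (by omega), hn i (by omega)]
        obtain ⟨v'', hv'', i₂⟩ := dec_runs (W := W) (p := positions e)
          (n := update (update n m (f W e - 1 - j)) a (n a + (j + 1) * g W e))
          (n' := update (update n m (f W e - 1 - (j + 1))) a (n a + (j + 1) * g W e)) hM v' (by
            funext i; simp only [update_apply]; split_ifs <;> omega)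
        refine ⟨v'', ?_, i₁.seq ?_⟩
        · rw [hv'', update_of_ne (by omega), update_self, decide_eq_decide]; omega
        · rw [update_self, update_idem, add_assoc, ← Nat.succ_mul]
          exact i₂)
  refine ⟨v₃, (r₁.seq (r₂.seq (r₃.congr_config rfl ?_ rfl ?_))).mono ?_⟩
  · funext i; grind [update_apply]
  · funext i; grind [update_apply]
  · simp only [eval_add, eval_mul, eval_one]
    have := Nat.mul_le_mul_right (1 + (T₂.eval W.length + 1)) (hB W e he)
    omega

/-- Both sides are stored in scratch counters and the left one is subtracted from the right one. The
bounds limit the lengths of the subtracting and of the clearing loop. -/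
theorem Addable.le (hf : Addable f) (hg : Addable g)
    (hB : ∃ B : ℕ[X], ∀ W e, (∀ k, e k < W.length) → f W e ≤ B.eval W.length)
    (hC : ∃ B : ℕ[X], ∀ W e, (∀ k, e k < W.length) → g W e ≤ B.eval W.length) :
    Addable fun W e => if f W e ≤ g W e then 1 else 0 := by
  intro a m ham
  obtain ⟨B, hB⟩ := hB
  obtain ⟨C, hC⟩ := hC
  obtain ⟨h₁, H₁⟩ := hf m (m + 2) (by omega)
  -- With one added to the right side, the remainder `g + 1 - f` is positive exactly when `f ≤ g`.
  obtain ⟨h₂, H₂⟩ := hg.add .one (m + 1) (m + 2) (by omega)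
  refine ⟨h₁ + h₂ + m + 2, fun D hD => ?_⟩
  obtain ⟨P₁, T₁, hP₁⟩ := H₁ D (by omega)
  obtain ⟨P₂, T₂, hP₂⟩ := H₂ D (by omega)
  have hA : a < D := by omega
  have hM : m < D := by omega
  have hM' : m + 1 < D := by omega
  refine ⟨.seq P₁ (.seq P₂ (.seq (dec ⟨m, hM⟩) (.seq
    (.loop (fun v => v.isSome) (.seq (dec ⟨m + 1, hM'⟩) (dec ⟨m, hM⟩)))
    (.seq (dec ⟨m + 1, hM'⟩) (.seq (.ite (fun v => v.isSome) (inc ⟨a, hA⟩) .skip)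
      (.loop (fun v => v.isSome) (dec ⟨m + 1, hM'⟩))))))),
    T₁ + (T₂ + (1 + ((B * 3 + 1) + (1 + (2 + ((C + 1) * 2 + 1)))))), fun W e n v he hn => ?_⟩
  have hnm := hn m le_rfl
  have hnm' := hn (m + 1) (by omega)
  obtain ⟨v₁, r₁⟩ := hP₁ W e n v he fun j hj => hn j (by omega)
  rw [hnm, zero_add] at r₁
  obtain ⟨v₂, r₂⟩ := hP₂ W e (update n m (f W e)) v₁ he fun j hj => by
    rw [update_of_ne (by omega), hn j (by omega)]
  rw [update_of_ne (by omega), hnm', zero_add] at r₂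
  obtain ⟨v₃, hv₃, r₃⟩ := dec_runs (W := W) (p := positions e)
    (n := update (update n m (f W e)) (m + 1) (g W e + 1)) hM v₂ rfl
  obtain ⟨v₄, r₄⟩ := Runs.loop (p := fun v => v.isSome) (v := v₃)
    (a := .seq (dec ⟨m + 1, hM'⟩) (dec ⟨m, hM⟩)) (T := 2) (f W e)
    (fun j => config D W (positions e)
      (update (update n m (f W e - 1 - j)) (m + 1) (g W e + 1 - j)))
    (by rw [hv₃, update_of_ne (by omega), update_self]) (by
        intro j hj v
        obtain ⟨v', -, i₁⟩ := dec_runs (W := W) (p := positions e)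
          (n := update (update n m (f W e - 1 - j)) (m + 1) (g W e + 1 - j))
          (n' := update (update n m (f W e - 1 - j)) (m + 1) (g W e + 1 - (j + 1))) hM' v (by
            funext i; simp only [update_apply]; split_ifs <;> omega)
        obtain ⟨v'', hv'', i₂⟩ := dec_runs (W := W) (p := positions e)
          (n := update (update n m (f W e - 1 - j)) (m + 1) (g W e + 1 - (j + 1)))
          (n' := update (update n m (f W e - 1 - (j + 1))) (m + 1) (g W e + 1 - (j + 1))) hM v' (by
            funext i; simp only [update_apply]; split_ifs <;> omega)
        refine ⟨v'', ?_, i₁.seq i₂⟩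
        rw [hv'', update_of_ne (by omega), update_self, decide_eq_decide]; omega)
  obtain ⟨v₅, hv₅, r₅⟩ := dec_runs (W := W) (p := positions e)
    (n := update n (m + 1) (g W e + 1 - f W e))
    (n' := update n (m + 1) (g W e - f W e)) hM' v₄ (by
      funext i; simp only [update_apply]; split_ifs <;> omega)
  rw [update_self] at hv₅
  let n₁ := update n a (n a + if f W e ≤ g W e then 1 else 0)
  have r₆ : Runs (.ite (fun v => v.isSome) (inc ⟨a, hA⟩) .skip) v₅
      (config D W (positions e) (update n (m + 1) (g W e - f W e))) v₅
      (config D W (positions e) (update n₁ (m + 1) (g W e - f W e))) (1 + 1) := by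
    refine Runs.ite (fun h => inc_runs hA _ ?_) fun h => ?_
    · rw [hv₅, decide_eq_true_eq] at h
      have h' : f W e ≤ g W e := by omega
      funext i; simp only [n₁, if_pos h', update_apply]; split_ifs <;> omega
    · rw [hv₅, decide_eq_false_iff_not] at h
      have h' : ¬ f W e ≤ g W e := by omega
      simp only [n₁, if_neg h', add_zero, update_eq_self]
      exact (Exec.skip _ _).runs
  obtain ⟨v₇, r₇⟩ := Runs.loop (p := fun v => v.isSome) (v := v₅)
    (a := dec ⟨m + 1, hM'⟩) (T := 1) (g W e + 1 - f W e)
    (fun j => config D W (positions e) (update n₁ (m + 1) (g W e - f W e - j))) hv₅ (by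
        intro j hj v
        obtain ⟨v', hv', i₁⟩ := dec_runs (W := W) (p := positions e)
          (n := update n₁ (m + 1) (g W e - f W e - j))
          (n' := update n₁ (m + 1) (g W e - f W e - (j + 1))) hM' v (by
            funext i; simp only [update_apply]; split_ifs <;> omega)
        refine ⟨v', ?_, i₁⟩
        rw [hv', update_self, decide_eq_decide]; omega)
  have hB' := hB W e he
  have hC' := hC W e he
  refine ⟨v₇, (r₁.seq (r₂.seq (r₃.seq (.seq (r₄.congr_config rfl ?_ rfl ?_)
    (r₅.seq (r₆.seq (r₇.congr_config rfl ?_ rfl ?_))))))).mono ?_⟩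
  · funext i; grind [update_apply]
  · funext i; grind [update_apply]
  · rfl
  · funext i; grind [update_apply]
  · simp only [eval_add, eval_mul, eval_one, eval_ofNat]
    omega

/-- The zipper with index `d` plays the bound variable: it scans the word, the program for the
summand runs at each position, and the zipper is rewound. -/
theorem Addable.sum {f : List Γ → (Fin (d + 1) → ℕ) → ℕ} (hf : Addable f) :
    Addable fun W (e : Fin d → ℕ) =>
      ∑ v ∈ Finset.range W.length, f W (Fin.snoc (α := fun _ => ℕ) e v) := by
  intro a m ham
  obtain ⟨h₁, H₁⟩ := hf a m ham
  refine ⟨h₁ + d + 1, fun D hD => ?_⟩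
  obtain ⟨P, T, hP⟩ := H₁ D (by omega)
  have hd : d < D := by omega
  refine ⟨.seq (look ⟨d, hd⟩) (.seq (.loop (fun v => v.isSome)
    (.seq P (.seq (moveRight ⟨d, hd⟩) (look ⟨d, hd⟩)))) (.seq (moveLeft ⟨d, hd⟩)
      (.loop (fun v => v.isSome) (moveLeft ⟨d, hd⟩)))),
    1 + ((X * (1 + (T + 3)) + 1) + (3 + (X * 4 + 1))), fun W e n v he hn => ?_⟩
  set N := W.length with hN
  -- Zippers that stand for no variable rest at the beginning of the word.
  have hpd : positions e d = 0 := by simp [positions]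
  have r₁ := look_runs (W := W) (p := positions e) (n := n) hd v
  rw [hpd] at r₁
  obtain ⟨v₂, r₂⟩ := Runs.loop (p := fun v => v.isSome) (v := W[0]?.map some)
    (a := .seq P (.seq (moveRight ⟨d, hd⟩) (look ⟨d, hd⟩))) (T := T.eval N + 3) N
    (fun j => config D W (update (positions e) d j)
      (update n a (n a + ∑ v ∈ Finset.range j, f W (Fin.snoc (α := fun _ => ℕ) e v))))
    (by rcases W with _ | ⟨x, W⟩ <;> simp [hN]) (by
        intro j hj v
        have he' : ∀ k, (Fin.snoc (α := fun _ => ℕ) e j : Fin (d + 1) → ℕ) k < W.length := by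
          intro k
          refine Fin.lastCases ?_ (fun k => ?_) k
          · simpa using hj
          · simpa using he k
        obtain ⟨v', i₁⟩ := hP W _ (update n a (n a + ∑ v ∈ Finset.range j,
          f W (Fin.snoc (α := fun _ => ℕ) e v))) v he' fun i hi => by
            rw [update_of_ne (by omega), hn i hi]
        rw [positions_snoc, update_self, update_idem, add_assoc, ← Finset.sum_range_succ] at i₁
        obtain ⟨v'', i₂⟩ := moveRight_runs (W := W) (p := update (positions e) d j)
          (p' := update (positions e) d (j + 1)) (n := update n a (n a + ∑ v ∈ Finset.range (j + 1),
          f W (Fin.snoc (α := fun _ => ℕ) e v))) hd v' (by simpa using hj) (by simp)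
        have i₃ := look_runs (W := W) (p := update (positions e) d (j + 1))
          (n := update n a (n a + ∑ v ∈ Finset.range (j + 1),
          f W (Fin.snoc (α := fun _ => ℕ) e v))) hd v''
        rw [update_self] at i₃
        refine ⟨_, ?_, i₁.seq (i₂.seq i₃)⟩
        by_cases h : j + 1 < N <;> simp [h, hN ▸ h])
  set n₁ := update n a (n a + ∑ v ∈ Finset.range N, f W (Fin.snoc (α := fun _ => ℕ) e v))
  obtain ⟨v₃, hv₃, r₃⟩ := moveLeft_runs (W := W) (p := update (positions e) d N)
    (p' := update (positions e) d (N - 1)) (n := n₁) hd v₂ (by simp [hN]) (by simp)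
  rw [update_self] at hv₃
  obtain ⟨v₄, r₄⟩ := Runs.loop (p := fun v => v.isSome) (v := v₃)
    (a := moveLeft ⟨d, hd⟩) (T := 3) N
    (fun j => config D W (update (positions e) d (N - 1 - j)) n₁) hv₃ (by
        intro j hj v
        obtain ⟨v', hv', i₁⟩ := moveLeft_runs (W := W) (p := update (positions e) d (N - 1 - j))
          (p' := update (positions e) d (N - 1 - (j + 1))) (n := n₁) hd v
          (by simp; omega) (by simp; congr 1)
        refine ⟨v', ?_, i₁⟩
        rw [hv', update_self, decide_eq_decide]; omega)
  refine ⟨v₄, (r₁.seq (.seq (r₂.congr_config ?_ ?_ rfl rfl)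
    (r₃.seq (r₄.congr_config rfl rfl ?_ rfl)))).mono ?_⟩
  · rw [← hpd, update_eq_self]
  · simp
  · rw [show N - 1 - N = 0 by omega, ← hpd, update_eq_self]
  · simp

/-- The two claims are proved together because the running times for products and comparisons depend
on the sizes of the operands. -/
theorem Definable.bounded_and_addable (h : Definable d f) :
    (∃ B : ℕ[X], ∀ W e, (∀ k, e k < W.length) → f W e ≤ B.eval W.length) ∧ Addable f := by
  induction h with
  | const c => exact ⟨⟨c, fun W e _ => by simp⟩, .const c⟩
  | var k => exact ⟨⟨X, fun W e he => by simpa using (he k).le⟩, .var k⟩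
  | symbol k s => exact ⟨⟨1, fun W e _ => by dsimp only; split_ifs <;> simp⟩, .symbol k s⟩
  | add _ _ hf hg =>
    obtain ⟨⟨B, hB⟩, hf⟩ := hf
    obtain ⟨⟨C, hC⟩, hg⟩ := hg
    exact ⟨⟨B + C, fun W e he => by simpa using Nat.add_le_add (hB W e he) (hC W e he)⟩, hf.add hg⟩
  | mul _ _ hf hg =>
    obtain ⟨⟨B, hB⟩, hf⟩ := hf
    obtain ⟨⟨C, hC⟩, hg⟩ := hg
    exact ⟨⟨B * C, fun W e he => by simpa using Nat.mul_le_mul (hB W e he) (hC W e he)⟩,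
      hf.mul hg ⟨B, hB⟩⟩
  | le _ _ hf hg =>
    exact ⟨⟨1, fun W e _ => by dsimp only; split_ifs <;> simp⟩, hf.2.le hg.2 hf.1 hg.1⟩
  | sum _ hf =>
    obtain ⟨⟨B, hB⟩, hf⟩ := hf
    refine ⟨⟨X * B, fun W e he => ?_⟩, hf.sum⟩
    rw [eval_mul, eval_X]
    refine (Finset.sum_le_card_nsmul _ _ (B.eval W.length) fun v hv => hB _ _ fun k => ?_).trans
      (by simp)
    refine Fin.lastCases ?_ (fun k => ?_) k
    · simpa using hv
    · simpa using he k
  | congr _ h hf =>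
    obtain ⟨⟨B, hB⟩, hf⟩ := hf
    exact ⟨⟨B, fun W e he => h W e he ▸ hB W e he⟩, hf.congr h⟩

end StackProg

/-! ### From programs to Turing machines. -/

namespace StackProg

open Function Polynomial Turing

variable {Γ : Type} {D : ℕ} {W : List Γ}

/-- Push the symbol in the internal state to the left stacks of the first `m` zippers. -/
def pushAll : (m : ℕ) → m ≤ D → Verifier Γ D
  | 0, _ => .skip
  | m + 1, h => .seq (pushAll m (by omega)) (.push (.left ⟨m, h⟩) fun v => v.getD none)

theorem pushAll_runs (m : ℕ) (hm : m ≤ D) (i : List Γ) (L : ℕ → List (Option Γ)) (x : Option Γ) :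
    Runs (pushAll m hm) (some x) (layout i [] L (fun _ => []) fun _ => []) (some x)
      (layout i [] (fun k => if k < m then x :: L k else L k) (fun _ => []) fun _ => [])
      (m + 1) := by
  induction m with
  | zero => simpa [pushAll] using (Exec.skip _ _).runs
  | succ m ih =>
    refine (ih (by omega)).seq ?_
    have h := (Exec.push (Γ := Alphabet Γ D) (σ := Option (Option Γ)) (Key.left ⟨m, hm⟩)
      (fun v => v.getD none) (some x) (layout i [] (fun k => if k < m then x :: L k else L k)
        (fun _ => []) fun _ => [])).runs
    rw [update_left] at h
    convert h using 2
    funext k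
    simp only [layout, update_apply]
    grind

/-- Move the input to the left stacks of all zippers. -/
def load : Verifier Γ D :=
  .seq (.pop .input fun _ s => s.map some)
    (.loop (fun v => v.isSome) (.seq (pushAll D le_rfl) (.pop .input fun _ s => s.map some)))

/-- Popping reverses the input, and a reversed word on a left stack is a zipper at the right end. -/
theorem load_runs (W : List Γ) :
    ∃ v, Runs (load : Verifier Γ D) none (layout W [] (fun _ => []) (fun _ => []) fun _ => []) v
      (config D W (fun _ => W.length) fun _ => 0) (1 + (W.length * (1 + (D + 1 + 1)) + 1)) := by
  have h₀ : ∀ (i : List Γ) (v) (L : ℕ → List (Option Γ)),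
      Runs (.pop .input fun _ s => s.map some : Verifier Γ D) v
        (layout i [] L (fun _ => []) fun _ => []) (i.head?.map some)
        (layout i.tail [] L (fun _ => []) fun _ => []) 1 := fun i v L => by
    have h := (Exec.pop (Γ := Alphabet Γ D) (σ := Option (Option Γ)) Key.input
      (fun _ s => s.map some) v (layout i [] L (fun _ => []) fun _ => [])).runs
    rw [update_input] at h
    exact h
  have : ∀ (W : List Γ) (v : Option (Option Γ)) (L : List (Option Γ)), v = W.head?.map some →
      ∃ v', Runs (.loop (fun v => v.isSome) (.seq (pushAll D le_rfl)
        (.pop .input fun _ s => s.map some)) : Verifier Γ D) v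
          (layout W.tail [] (fun _ => L) (fun _ => []) fun _ => []) v'
          (layout [] [] (fun _ => W.reverse.map some ++ L) (fun _ => []) fun _ => [])
          (W.length * (1 + (D + 1 + 1)) + 1) := by
    intro W
    induction W with
    | nil =>
      rintro v L rfl
      exact ⟨_, (Exec.loop_false rfl).runs.mono (by simp)⟩
    | cons x W ih =>
      rintro v L rfl
      obtain ⟨v', t, ht, hx⟩ := ih _ (some x :: L) rfl
      obtain ⟨s, hs, hy⟩ := (pushAll_runs D le_rfl W (fun _ => L) (some x)).seq
        (h₀ W (some (some x)) _)
      refine ⟨v', 1 + s + t, ?_, .loop_true rfl hy ?_⟩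
      · simp only [List.length_cons, Nat.succ_mul]; omega
      · convert hx using 1
        · exact layout_congr (fun k hk => by simp [hk]) (fun _ _ => rfl) fun _ _ => rfl
        · simp
  obtain ⟨v', h⟩ := this W _ [] rfl
  refine ⟨v', (h₀ W none _).seq ?_⟩
  convert h using 1
  exact layout_congr (fun k _ => by simp) (fun k _ => by simp) fun k _ => by simp

/-- Move the first `m` zippers to the beginning of the word. -/
def rewind : (m : ℕ) → m ≤ D → Verifier Γ D
  | 0, _ => .skip
  | m + 1, h => .seq (rewind m (by omega)) (.seq (moveLeft ⟨m, h⟩)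
      (.loop (fun v => v.isSome) (moveLeft ⟨m, h⟩)))

theorem rewind_runs (m : ℕ) (hm : m ≤ D) (v) (n : ℕ → ℕ) :
    ∃ v', Runs (rewind m hm) v (config D W (fun _ => W.length) n) v'
      (config D W (fun k => if k < m then 0 else W.length) n) (m * (W.length * 4 + 4) + 1) := by
  induction m with
  | zero => exact ⟨v, by simpa [rewind] using (Exec.skip _ _).runs⟩
  | succ m ih =>
    obtain ⟨v₁, r₁⟩ := ih (by omega)
    obtain ⟨v₂, hv₂, r₂⟩ := moveLeft_runs (W := W) (n := n)
      (p := fun k => if k < m then 0 else W.length)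
      (p' := fun k => if k < m then 0 else if k = m then W.length - 1 else W.length) hm v₁
      (by simp) (by funext k; simp only [update_apply]; grind)
    obtain ⟨v₃, r₃⟩ := Runs.loop (p := fun v => v.isSome) (v := v₂)
      (a := moveLeft ⟨m, hm⟩) (T := 3) W.length
      (fun j => config D W
        (fun k => if k < m then 0 else if k = m then W.length - 1 - j else W.length) n)
      (by simpa using hv₂) (by
        intro j hj v
        obtain ⟨v', hv', i₁⟩ := moveLeft_runs (W := W) (n := n)
          (p := fun k => if k < m then 0 else if k = m then W.length - 1 - j else W.length)
          (p' := fun k => if k < m then 0 else if k = m then W.length - 1 - (j + 1) else W.length)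
          hm v (by simp; omega) (by funext k; simp only [update_apply]; grind)
        refine ⟨v', ?_, i₁⟩
        simp only [hv', lt_irrefl, if_false, if_true, decide_eq_decide]; omega)
    refine ⟨v₃, (r₁.seq (r₂.seq (r₃.congr_config rfl rfl ?_ rfl))).mono ?_⟩
    · funext k; grind
    · rw [Nat.succ_mul]; omega

/-- Remove everything from the right stacks of the first `m` zippers. -/
def clear : (m : ℕ) → m ≤ D → Verifier Γ D
  | 0, _ => .skip
  | m + 1, h => .seq (clear m (by omega)) (.seq (.pop (.right ⟨m, h⟩) fun _ s => s)
      (.loop (fun v => v.isSome) (.pop (.right ⟨m, h⟩) fun _ s => s)))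

theorem clear_runs (m : ℕ) (hm : m ≤ D) (v) (o : List Bool) (w : List (Option Γ)) :
    ∃ v', Runs (clear m hm) v (layout [] o (fun _ => []) (fun _ => w) fun _ => []) v'
      (layout [] o (fun _ => []) (fun k => if k < m then [] else w) fun _ => [])
      (m * (w.length * 2 + 2) + 1) := by
  induction m with
  | zero => exact ⟨v, by simpa [clear] using (Exec.skip _ _).runs⟩
  | succ m ih =>
    obtain ⟨v₁, r₁⟩ := ih (by omega)
    have h₀ : ∀ (j : ℕ) (v),
        Runs (.pop (.right ⟨m, hm⟩) fun _ s => s : Verifier Γ D) v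
          (layout [] o (fun _ => []) (fun k => if k < m then [] else if k = m then w.drop j else w)
            fun _ => []) w[j]?
          (layout [] o (fun _ => [])
            (fun k => if k < m then [] else if k = m then w.drop (j + 1) else w)
            fun _ => []) 1 := fun j v => by
      have h := (Exec.pop (Γ := Alphabet Γ D) (σ := Option (Option Γ)) (Key.right ⟨m, hm⟩)
        (fun _ s => s) v (layout [] o (fun _ => [])
          (fun k => if k < m then [] else if k = m then w.drop j else w) fun _ => [])).runs
      rw [update_right] at h
      convert h using 1
      · simp [layout]
      · congr 1
        funext k
        simp only [update_apply, layout, ← List.tail_drop]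
        clear ih r₁ h
        grind
    obtain ⟨v₃, r₃⟩ := Runs.loop (p := fun v => v.isSome) (v := w[0]?)
      (a := .pop (.right ⟨m, hm⟩) fun _ s => s) (T := 1) w.length
      (fun j => layout [] o (fun _ => [])
        (fun k => if k < m then [] else if k = m then w.drop (j + 1) else w) fun _ => [])
      (by rcases w with _ | ⟨x, w⟩ <;> simp)
      (fun j hj v => ⟨_, by by_cases h : j + 1 < w.length <;> simp [h], h₀ (j + 1) v⟩)
    have h₁ := h₀ 0 v₁
    simp only [List.drop_zero, ite_self] at h₁
    refine ⟨v₃, (r₁.seq (h₁.seq (v₂ := v₃) (T₂ := w.length * (1 + 1) + 1) ?_)).mono ?_⟩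
    · convert r₃ using 2
      funext k
      simp only [List.drop_eq_nil_of_le (show w.length ≤ w.length + 1 by omega)]
      clear ih r₁ h₀ r₃
      grind
    · rw [Nat.succ_mul]; omega

/-- The result is 0 or 1, so a single pop reads it and empties its counter. Clearing the zippers and
resetting the state are needed because `haltList` prescribes empty stacks apart from the output, and
the initial state. -/
theorem Addable.exists_runs {f : List Γ → (Fin 0 → ℕ) → ℕ} (hf : Addable f) :
    ∃ (D : ℕ) (c : Verifier Γ D) (T : ℕ[X]), ∀ (W : List Γ) (b : Bool), f W ![] = b.toNat →
      Runs c none (layout W [] (fun _ => []) (fun _ => []) fun _ => []) none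
        (layout [] [b] (fun _ => []) (fun _ => []) fun _ => []) (T.eval W.length) := by
  obtain ⟨h, H⟩ := hf 0 1 one_pos
  obtain ⟨D, hD⟩ : ∃ D, D = h + 1 := ⟨_, rfl⟩
  obtain ⟨P, T, hP⟩ := H D (by omega)
  refine ⟨D, .seq load (.seq (rewind D le_rfl) (.seq P
    (.seq (.pop (.counter ⟨0, by omega⟩) fun _ s => s) (.seq (.push .output fun v => v.isSome)
      (.seq (clear D le_rfl) (.peek .input fun _ _ => none)))))),
    (1 + (X * (C (1 + (D + 1 + 1))) + 1)) + ((C D * (X * 4 + 4) + 1) + (T + (1 + (1 +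
      ((C D * (X * 2 + 2) + 1) + 1))))), fun W b hb => ?_⟩
  obtain ⟨v₁, r₁⟩ := load_runs (D := D) W
  obtain ⟨v₂, r₂⟩ := rewind_runs (W := W) D le_rfl v₁ fun _ => 0
  obtain ⟨v₃, r₃⟩ := hP W ![] (fun _ => 0) v₂ (fun k => k.elim0) fun _ _ => rfl
  have hp : (config D W (positions ![]) fun _ => 0) =
      config D W (fun k => if k < D then 0 else W.length) fun _ => 0 :=
    layout_congr (fun k hk => by simp [hk, positions]) (fun k hk => by simp [hk, positions])
      fun _ _ => rfl
  rw [hp] at r₃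
  have r₄ := (Exec.pop (Γ := Alphabet Γ D) (σ := Option (Option Γ)) (Key.counter ⟨0, by omega⟩)
    (fun _ s => s) v₃ (config D W (positions ![]) (update (fun _ => 0) 0 b.toNat))).runs
  have hc : update (config D W (positions ![]) (update (fun _ => 0) 0 b.toNat))
      (Key.counter ⟨0, by omega⟩) [] =
      layout [] [] (fun _ => []) (fun _ => W.map some) fun _ => [] := by
    unfold config
    rw [update_counter]
    refine layout_congr (fun k hk => by simp [positions]) (fun k hk => by simp [positions])
      fun k _ => ?_
    rcases eq_or_ne k 0 with rfl | hk <;> simp [*]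
  have hb' : (config D W (positions ![]) (update (fun _ => 0) 0 b.toNat)
      (Key.counter ⟨0, by omega⟩)).tail = [] := by
    rw [config_counter]; cases b <;> simp
  have hb'' : ((config D W (positions ![]) (update (fun _ => 0) 0 b.toNat)
      (Key.counter ⟨0, by omega⟩)).head?).isSome = b := by
    rw [config_counter]; cases b <;> simp
  rw [hb', hc] at r₄
  set v₄ := (config D W (positions ![]) (update (fun _ => 0) 0 b.toNat)
      (Key.counter ⟨0, by omega⟩)).head?
  have r₅ := (Exec.push (Γ := Alphabet Γ D) (σ := Option (Option Γ)) Key.output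
    (fun v => v.isSome) v₄ (layout [] [] (fun _ => []) (fun _ => W.map some) fun _ => [])).runs
  rw [update_output, hb''] at r₅
  obtain ⟨v₆, r₆⟩ := clear_runs D le_rfl v₄ [b] (W.map some)
  have r₇ := (Exec.peek (Γ := Alphabet Γ D) (σ := Option (Option Γ)) Key.input
    (fun _ _ => none) v₆ (layout [] [b] (fun _ => [])
      (fun k => if k < D then [] else W.map some) fun _ => [])).runs
  have he : (layout [] [b] (fun _ => []) (fun k => if k < D then [] else W.map some)
      fun _ => [] : ∀ k : Key D, _) =
      layout [] [b] (fun _ => []) (fun _ => []) fun _ => [] :=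
    layout_congr (fun _ _ => rfl) (fun k hk => if_pos hk) fun _ _ => rfl
  rw [he] at r₆ r₇
  refine (r₁.seq (r₂.seq (.seq (v₁ := v₃) r₃ (.seq (v₁ := v₄) (T₁ := 1) ?_
    (r₅.seq (r₆.seq r₇)))))).mono ?_
  · convert r₄ using 2
    rw [hb, zero_add]
  · simp

/-- Definable properties can be checked in polynomial time. -/
theorem polyTime_of_definable [Fintype Γ] {α : Type} (ea : α → List Γ) (V : α → Bool)
    {f : List Γ → (Fin 0 → ℕ) → ℕ} (hf : Definable 0 f)
    (hV : ∀ x, f (ea x) ![] = (V x).toNat) :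
    Nonempty (TM2ComputableInPolyTime ea Computability.encodeBool V) := by
  obtain ⟨D, c, T, h⟩ := (Definable.bounded_and_addable hf).2.exists_runs
  let := labelFintype c
  let m : Option (Label c) → TM2.Stmt (Alphabet Γ D) (Option (Label c)) (Option (Option Γ))
    | none => .halt
    | some l => code c some none l
  let tm : FinTM2 :=
    { K := Key D
      k₀ := .input
      k₁ := .output
      Γ := Alphabet Γ D
      Λ := Option (Label c)
      main := some (entry c)
      σ := Option (Option Γ)
      initialState := none
      Γk₀Fin := inferInstanceAs (Fintype Γ)
      m := m }
  -- The additional step executes `halt` at the exit label `none`.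
  have key : ∀ x, ∃ t ≤ (T + 1).eval (ea x).length,
      ReachesIn m t ⟨some (some (entry c)), none,
        layout (ea x) [] (fun _ => []) (fun _ => []) fun _ => []⟩
        ⟨none, none, layout [] [V x] (fun _ => []) (fun _ => []) fun _ => []⟩ := by
    intro x
    obtain ⟨t, ht, hx⟩ := h (ea x) (V x) (hV x)
    exact ⟨t + 1, by simpa using ht, (hx.reachesIn some none fun _ => rfl).trans
      (ReachesIn.single rfl)⟩
  choose t ht hr using key
  have hi : ∀ W : List Γ, initList tm W =
      ⟨some (some (entry c)), none, layout W [] (fun _ => []) (fun _ => []) fun _ => []⟩ := by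
    intro W
    unfold initList
    congr 1
    funext k
    cases k <;> rfl
  have ho : ∀ W : List Bool, haltList tm W =
      ⟨none, none, layout [] W (fun _ => []) (fun _ => []) fun _ => []⟩ := by
    intro W
    unfold haltList
    congr 1
    funext k
    cases k <;> rfl
  exact ⟨{
    tm := tm
    inputAlphabet := Equiv.refl Γ
    outputAlphabet := Equiv.refl Bool
    time := T + 1
    outputsFun := fun x =>
      { steps := t x
        evals_in_steps := by
          rw [Equiv.invFun_as_coe, Equiv.refl_symm, Equiv.coe_refl, List.map_id, hi]
          refine Eq.trans (hr x) ?_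
          rw [Option.map_some, ho]
          rfl
        steps_le_m := ht x } }⟩

end StackProg

/-! ### Closure properties of definable functions and predicates. -/

/-- The properties whose characteristic function is definable. -/
def DefinablePred {Γ : Type} (d : ℕ) (p : List Γ → (Fin d → ℕ) → Prop) : Prop :=
  Definable d fun W e => open scoped Classical in if p W e then 1 else 0

section Definability

variable {Γ : Type} {d : ℕ} {f g : List Γ → (Fin d → ℕ) → ℕ} {p q : List Γ → (Fin d → ℕ) → Prop}

namespace DefinablePred

theorem congr (hp : DefinablePred d p) (h : ∀ W e, (∀ k, e k < W.length) → (p W e ↔ q W e)) :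
    DefinablePred d q :=
  Definable.congr hp fun W e he => by
    by_cases hq : q W e <;> simp [h W e he, hq]

theorem indicator [∀ W e, Decidable (p W e)] (hp : DefinablePred d p) :
    Definable d fun W e => if p W e then 1 else 0 :=
  Definable.congr hp fun W e _ => by congr!

theorem of_iff (hp : DefinablePred d p) (h : ∀ W e, q W e ↔ p W e) : DefinablePred d q :=
  hp.congr fun W e _ => (h W e).symm

theorem le (hf : Definable d f) (hg : Definable d g) :
    DefinablePred d fun W e => f W e ≤ g W e :=
  (Definable.le hf hg).congr fun W e _ => by congr

theorem lt (hf : Definable d f) (hg : Definable d g) :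
    DefinablePred d fun W e => f W e < g W e :=
  le (hf.add (.const 1)) hg

theorem not (hp : DefinablePred d p) : DefinablePred d fun W e => ¬ p W e :=
  (Definable.le hp (.const 0)).congr fun W e _ => by by_cases h : p W e <;> simp [h]

theorem and (hp : DefinablePred d p) (hq : DefinablePred d q) :
    DefinablePred d fun W e => p W e ∧ q W e :=
  (Definable.mul hp hq).congr fun W e _ => by
    by_cases h : p W e <;> by_cases h' : q W e <;> simp [h, h']

theorem or (hp : DefinablePred d p) (hq : DefinablePred d q) :
    DefinablePred d fun W e => p W e ∨ q W e :=
  (hp.not.and hq.not).not.of_iff fun _ _ => by tauto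

theorem imp (hp : DefinablePred d p) (hq : DefinablePred d q) :
    DefinablePred d fun W e => p W e → q W e :=
  (hp.and hq.not).not.of_iff fun _ _ => by tauto

theorem iff (hp : DefinablePred d p) (hq : DefinablePred d q) :
    DefinablePred d fun W e => (p W e ↔ q W e) :=
  ((hp.imp hq).and (hq.imp hp)).of_iff fun _ _ => by tauto

theorem eq (hf : Definable d f) (hg : Definable d g) :
    DefinablePred d fun W e => f W e = g W e :=
  ((le hf hg).and (le hg hf)).of_iff fun _ _ => by omega

theorem false : DefinablePred d fun (_ : List Γ) _ => False :=
  (lt (.const 0) (.const 0)).of_iff fun _ _ => by simp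

end DefinablePred

open scoped Classical in
theorem Definable.ite (hp : DefinablePred d p) (hf : Definable d f) (hg : Definable d g) :
    Definable d fun W e => if p W e then f W e else g W e :=
  ((Definable.mul hp hf).add (Definable.mul hp.not hg)).congr fun W e _ => by
    by_cases h : p W e <;> simp [h]

theorem Definable.sum_range_length {f : List Γ → (Fin d → ℕ) → ℕ → ℕ}
    (h : Definable (d + 1) fun W e => f W (Fin.init e) (e (Fin.last d))) :
    Definable d fun W e => ∑ v ∈ Finset.range W.length, f W e v :=
  h.sum.congr fun W e _ => by simp

/-- A variable is a position and hence below the length of the word, so this is the sum over all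
positions cut off by an indicator. -/
theorem Definable.sum_range (k : Fin d) {f : List Γ → (Fin d → ℕ) → ℕ → ℕ}
    (h : Definable (d + 1) fun W e => f W (Fin.init e) (e (Fin.last d))) :
    Definable d fun W e => ∑ v ∈ Finset.range (e k), f W e v := by
  have h' : Definable (d + 1) fun W e =>
      if e (Fin.last d) < Fin.init (α := fun _ => ℕ) e k then
        f W (Fin.init e) (e (Fin.last d)) else 0 := by
    classical
    refine (Definable.ite (.lt (.var (Fin.last d)) (.var k.castSucc)) h (.const 0)).congr
      fun W e _ => ?_
    congr
  refine (Definable.sum_range_length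
    (f := fun W e v => if v < e k then f W e v else 0) h').congr fun W e he => ?_
  rw [← Finset.sum_filter]
  congr 1
  ext v
  have := he k
  simp only [Finset.mem_filter, Finset.mem_range]
  omega

/-- Binders use the last variable, so functions have to be moved under them. In the case of a sum
the renaming is extended to fix the bound variable. -/
theorem Definable.rename (hf : Definable d f) {d' : ℕ} (r : Fin d → Fin d') :
    Definable d' fun W e => f W fun k => e (r k) := by
  induction hf generalizing d' with
  | const c => exact .const c
  | var k => exact .var (r k)
  | symbol k s => exact .symbol (r k) s
  | add _ _ hf hg => exact (hf r).add (hg r)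
  | mul _ _ hf hg => exact (hf r).mul (hg r)
  | le _ _ hf hg => exact (hf r).le (hg r)
  | @sum d f _ hf =>
    refine (hf (Fin.lastCases (Fin.last d') fun k => (r k).castSucc)).sum.congr fun W e _ => ?_
    refine Finset.sum_congr rfl fun v _ => congrArg (f W) ?_
    funext k
    refine Fin.lastCases ?_ (fun k => ?_) k <;> simp
  | congr _ h hf => exact (hf r).congr fun W e he => h W _ fun k => he (r k)

namespace DefinablePred

theorem exists_lt_length {p : List Γ → (Fin d → ℕ) → ℕ → Prop}
    (h : DefinablePred (d + 1) fun W e => p W (Fin.init e) (e (Fin.last d))) :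
    DefinablePred d fun W e => ∃ v < W.length, p W e v := by
  classical
  refine (lt (.const 0) (Definable.sum_range_length
    (f := fun W e v => if p W e v then 1 else 0) (h.congr fun _ _ _ => Iff.rfl))).of_iff
    fun W e => ?_
  rw [Finset.sum_boole, Nat.cast_id, Finset.card_pos]
  simp [Finset.Nonempty]

theorem forall_lt_length {p : List Γ → (Fin d → ℕ) → ℕ → Prop}
    (h : DefinablePred (d + 1) fun W e => p W (Fin.init e) (e (Fin.last d))) :
    DefinablePred d fun W e => ∀ v < W.length, p W e v :=
  (exists_lt_length (p := fun W e v => ¬ p W e v) h.not).not.of_iff fun W e => by simp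

theorem exists_lt (k : Fin d) {p : List Γ → (Fin d → ℕ) → ℕ → Prop}
    (h : DefinablePred (d + 1) fun W e => p W (Fin.init e) (e (Fin.last d))) :
    DefinablePred d fun W e => ∃ v < e k, p W e v :=
  (exists_lt_length (p := fun W e v => v < e k ∧ p W e v)
    ((lt (.var (Fin.last d)) (.var k.castSucc)).and h)).congr fun _ _ he =>
      ⟨fun ⟨v, _, h⟩ => ⟨v, h⟩, fun ⟨v, h⟩ => ⟨v, h.1.trans (he k), h⟩⟩

theorem forall_lt (k : Fin d) {p : List Γ → (Fin d → ℕ) → ℕ → Prop}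
    (h : DefinablePred (d + 1) fun W e => p W (Fin.init e) (e (Fin.last d))) :
    DefinablePred d fun W e => ∀ v < e k, p W e v :=
  (exists_lt k (p := fun W e v => ¬ p W e v) h.not).not.of_iff fun W e => by simp

theorem exists_fintype {α : Type} [Fintype α] {p : α → List Γ → (Fin d → ℕ) → Prop}
    (h : ∀ a, DefinablePred d (p a)) : DefinablePred d fun W e => ∃ a, p a W e := by
  classical
  have : ∀ s : Finset α, DefinablePred d fun W e => ∃ a ∈ s, p a W e := by
    intro s
    induction s using Finset.induction_on with
    | empty => exact false.of_iff fun _ _ => by simp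
    | insert a s _ ih => exact ((h a).or ih).of_iff fun _ _ => by simp
  exact (this Finset.univ).of_iff fun _ _ => by simp

/-- The symbol at a definable position can be tested. -/
theorem any_getElem? (hf : Definable d f) (s : Γ → Bool) :
    DefinablePred d fun W e => W[f W e]?.any s = true := by
  have hs : DefinablePred (d + 1) fun W e => W[e (Fin.last d)]?.any s = true :=
    (Definable.symbol (Fin.last d) s).congr fun W e _ => by congr
  -- Only variables can be inspected directly, so the position is named by a bounded quantifier.
  refine (exists_lt_length (p := fun W e v => v = f W e ∧ W[v]?.any s = true)
    ((eq (.var (Fin.last d)) (hf.rename Fin.castSucc)).and hs)).of_iff fun W e => ?_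
  constructor
  · intro h
    obtain ⟨a, ha, -⟩ := (Option.any_eq_true _ _).1 h
    exact ⟨_, (List.getElem?_eq_some_iff.1 ha).1, rfl, h⟩
  · rintro ⟨_, -, rfl, h⟩
    exact h

end DefinablePred

end Definability

open Computability in
/-- A language is in NP if its members are characterized by short certificates and a definable
property. -/
theorem InNP.of_definablePred {A B : Type} [Fintype A] [Fintype B] {L : Language A}
    (q : Polynomial ℕ) {p : List (A ⊕ B) → Prop} (hp : DefinablePred 0 fun W _ => p W)
    (h : ∀ x : List A, x ∈ L ↔
      ∃ w : List B, w.length ≤ q.eval x.length ∧ p (x.map .inl ++ w.map .inr)) : InNP L := by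
  classical
  refine ⟨B, inferInstance, q, fun x => decide (p (x.1.map .inl ++ x.2.map .inr)), ?_, ?_⟩
  · refine StackProg.polyTime_of_definable _ _ hp fun x => ?_
    by_cases hx : p (x.1.map .inl ++ x.2.map .inr) <;> simp [encodingProd, encodingList, hx]
  · simpa using h

/-! ### Preferences in terms of natural numbers. -/

namespace ACFG

open Finset

section

open scoped Classical

/-- The value of agent `i`, increased by the number `n` of agents, for the network of friends `A`
and the coalitions `P`. -/
noncomputable def natValue (n : ℕ) (A P : ℕ → ℕ → Prop) (i : ℕ) : ℕ :=
  n * (∑ j ∈ range n, if P i j ∧ A i j then 1 else 0) +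
    ∑ j ∈ range n, if ¬ (P i j ∧ ¬ A i j ∧ j ≠ i) then 1 else 0

/-- A natural number that is, up to a summand that does not depend on `P`, the aggregated value of
the agents with the property `S`. -/
noncomputable def natAggregate (a : Aggregation) (N n : ℕ) (A P : ℕ → ℕ → Prop) (S : ℕ → Prop) :
    ℕ :=
  match a with
  | .sumBased => ∑ f ∈ range n, if S f then natValue n A P f else 0
  | .minBased => ∑ k ∈ range N, if ∀ f < n, S f → k < natValue n A P f then 1 else 0

end

/-- Agent `i` prefers the coalitions `Q` to the coalitions `P`. -/
def Improves (a : Aggregation) (d : Altruism) (N n : ℕ) (A P Q : ℕ → ℕ → Prop) (i : ℕ) : Prop :=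
  match d with
  | .selfishFirst => natValue n A P i < natValue n A Q i ∨
      natValue n A P i = natValue n A Q i ∧
        natAggregate a N n A P (A i) < natAggregate a N n A Q (A i)
  | .equalTreatment =>
      natAggregate a N n A P (fun f => A i f ∨ f = i) <
        natAggregate a N n A Q fun f => A i f ∨ f = i
  | .altruisticTreatment => natAggregate a N n A P (A i) < natAggregate a N n A Q (A i) ∨
      natAggregate a N n A P (A i) = natAggregate a N n A Q (A i) ∧
        natValue n A P i < natValue n A Q i

variable {g : ACFG} {Γ Δ : g.CoalitionStructure} {A P Q : ℕ → ℕ → Prop}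

theorem mem_friends {i j : Fin g.n} : j ∈ g.friends i ↔ g.network.Adj i j := by
  simp [friends]

theorem mem_enemies {i j : Fin g.n} : j ∈ g.enemies i ↔ ¬ g.network.Adj i j ∧ j ≠ i := by
  simp [enemies, mem_friends, and_comm]

theorem card_friends_lt (i : Fin g.n) : (g.friends i).card < g.n := by
  have h : g.friends i ⊂ univ := by
    refine ⟨subset_univ _, fun h => ?_⟩
    have := mem_friends.1 (h (mem_univ i))
    exact g.network.loopless.irrefl i this
  simpa using card_lt_card h

theorem card_enemies_lt (i : Fin g.n) : (g.enemies i).card < g.n := by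
  have h : g.enemies i ⊂ univ := by
    refine ⟨subset_univ _, fun h => ?_⟩
    exact (mem_enemies.1 (h (mem_univ i))).2 rfl
  simpa using card_lt_card h

theorem value_bounds (Γ : g.CoalitionStructure) (i : Fin g.n) :
    -((g.n : ℤ) - 1) ≤ g.value Γ i ∧ g.value Γ i ≤ g.n * (g.n - 1) := by
  have h₁ := (card_le_card (inter_subset_right (s₁ := Γ.part i) (s₂ := g.friends i))).trans_lt
    (card_friends_lt i)
  have h₂ := (card_le_card (inter_subset_right (s₁ := Γ.part i) (s₂ := g.enemies i))).trans_lt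
    (card_enemies_lt i)
  unfold value
  zify at h₁ h₂
  constructor <;> nlinarith

/-- Adding `n` replaces the subtraction of the enemies in the coalition by the count of all agents
that are not such enemies. -/
theorem natValue_eq (hA : ∀ i j : Fin g.n, A i j ↔ g.network.Adj i j)
    (hP : ∀ i j : Fin g.n, P i j ↔ j ∈ Γ.part i) (i : Fin g.n) :
    (natValue g.n A P i : ℤ) = g.value Γ i + g.n := by
  classical
  unfold natValue value
  rw [Finset.sum_range, Finset.sum_range, sum_boole, sum_boole, Nat.cast_id, Nat.cast_id]
  have h₁ : (univ.filter fun j : Fin g.n => P i j ∧ A i j) = Γ.part i ∩ g.friends i := by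
    ext j; simp [hA, hP, mem_friends]
  have h₂ : (univ.filter fun j : Fin g.n => ¬ (P i j ∧ ¬ A i j ∧ (j : ℕ) ≠ i)) =
      (Γ.part i ∩ g.enemies i)ᶜ := by
    ext j; simp [hA, hP, mem_enemies, Fin.ext_iff]; tauto
  rw [h₁, h₂, card_compl, Fintype.card_fin]
  have := (card_le_card (inter_subset_right (s₁ := Γ.part i) (s₂ := g.enemies i))).trans_lt
    (card_enemies_lt i)
  rw [Nat.cast_add, Nat.cast_mul, Nat.cast_sub this.le]
  ring

/-- A number is the count of the numbers below it. Since being below a minimum means being below all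
members, this turns a minimum into a sum. -/
theorem sum_lt_eq_min (N m : ℕ) (hm : m ≤ N) (p : ℕ → Prop) [DecidablePred p]
    (hp : ∀ k, p k ↔ k < m) : (∑ k ∈ range N, if p k then 1 else 0) = m := by
  rw [sum_boole, Nat.cast_id, filter_congr fun k _ => hp k]
  have : (range N).filter (fun k => k < m) = range m := by
    ext k; simp only [mem_filter, mem_range]; omega
  rw [this, card_range]

/-- Only differences are compared because the shift of the aggregate depends on the aggregation and
on `F`; it is the same for both structures and cancels. -/
theorem natAggregate_sub (hA : ∀ i j : Fin g.n, A i j ↔ g.network.Adj i j)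
    (hP : ∀ i j : Fin g.n, P i j ↔ j ∈ Γ.part i) (hQ : ∀ i j : Fin g.n, Q i j ↔ j ∈ Δ.part i)
    {N : ℕ} (hN : g.n * g.n ≤ N) {S : ℕ → Prop} {F : Finset (Fin g.n)}
    (hS : ∀ f : Fin g.n, S f ↔ f ∈ F) :
    (natAggregate g.aggregation N g.n A Q S : ℤ) - natAggregate g.aggregation N g.n A P S =
      g.aggregate Δ F - g.aggregate Γ F := by
  classical
  unfold natAggregate aggregate
  cases g.aggregation with
  | sumBased =>
    have key : ∀ (P : ℕ → ℕ → Prop) (Γ : g.CoalitionStructure),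
        (∀ i j : Fin g.n, P i j ↔ j ∈ Γ.part i) →
        ((∑ f ∈ range g.n, if S f then natValue g.n A P f else 0 : ℕ) : ℤ) =
          ∑ f ∈ F, g.value Γ f + F.card * g.n := by
      intro P Γ hP
      rw [Finset.sum_range, ← sum_filter]
      have : (univ.filter fun f : Fin g.n => S f) = F := by ext f; simp [hS]
      rw [this, Nat.cast_sum, sum_congr rfl fun f _ => natValue_eq hA hP f, sum_add_distrib]
      simp
    simp only [key Q Δ hQ, key P Γ hP]
    ring
  | minBased =>
    by_cases hF : F.Nonempty
    · have key : ∀ (P : ℕ → ℕ → Prop) (Γ : g.CoalitionStructure),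
          (∀ i j : Fin g.n, P i j ↔ j ∈ Γ.part i) →
          ((∑ k ∈ range N, if ∀ f < g.n, S f → k < natValue g.n A P f then 1 else 0 : ℕ) : ℤ) =
            F.inf' hF (g.value Γ) + g.n := by
        intro P Γ hP
        obtain ⟨f₀, hf₀, he⟩ := exists_mem_eq_inf' hF (g.value Γ)
        rw [sum_lt_eq_min N (natValue g.n A P f₀), he, natValue_eq hA hP]
        -- A shifted value is at most n(n - 1) + n = n², which is why `N` has to be at least n².
        · have := (value_bounds Γ f₀).2
          have h' := natValue_eq hA hP f₀
          zify at hN ⊢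
          nlinarith
        · intro k
          refine ⟨fun h => h f₀ f₀.2 ((hS f₀).2 hf₀), fun h f hf hs => h.trans_le ?_⟩
          have h₁ := natValue_eq hA hP f₀
          have h₂ := natValue_eq hA hP ⟨f, hf⟩
          have h₃ := inf'_le (g.value Γ) ((hS ⟨f, hf⟩).1 hs)
          rw [he] at h₃
          simp only at h₂
          omega
      simp only [key Q Δ hQ, key P Γ hP, dif_pos hF]
      ring
    -- For an empty set the condition under the sum is vacuous: both sums equal `N`, while both
    -- aggregates are zero.
    · have hS' : ∀ f < g.n, ¬ S f := fun f hf hs => hF ⟨⟨f, hf⟩, (hS ⟨f, hf⟩).1 hs⟩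
      simp only [dif_neg hF]
      rw [sum_congr rfl fun k _ => if_pos fun f hf hs => absurd hs (hS' f hf),
        sum_congr rfl fun k _ => if_pos fun f hf hs => absurd hs (hS' f hf)]
      simp

theorem abs_value_sub_le (Γ Δ : g.CoalitionStructure) (i : Fin g.n) :
    |g.value Δ i - g.value Γ i| ≤ (g.n : ℤ) ^ 2 - 1 := by
  have h₁ := value_bounds Γ i
  have h₂ := value_bounds Δ i
  rw [abs_le]
  constructor <;> nlinarith

/-- Values lie in an interval of length n² - 1. A sum has at most n - 1 terms, and (n - 1)(n² - 1) <
n³; a minimum over a nonempty set stays in the same interval. -/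
theorem abs_aggregate_sub_lt (Γ Δ : g.CoalitionStructure) (i : Fin g.n) :
    |g.aggregate Δ (g.friends i) - g.aggregate Γ (g.friends i)| < (g.n : ℤ) ^ 3 := by
  have hn : (1 : ℤ) ≤ g.n := by exact_mod_cast i.pos
  have hn2 : (g.n : ℤ) ^ 2 ≤ (g.n : ℤ) ^ 3 := pow_le_pow_right₀ hn (by norm_num)
  unfold aggregate
  cases g.aggregation with
  | sumBased =>
    dsimp only
    rw [← sum_sub_distrib]
    refine (abs_sum_le_sum_abs _ _).trans_lt
      ((sum_le_card_nsmul _ _ _ fun f _ => abs_value_sub_le Γ Δ f).trans_lt ?_)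
    have h := card_friends_lt i
    zify at h
    rw [nsmul_eq_mul]
    nlinarith [mul_nonneg (sub_nonneg.2 hn) (sub_nonneg.2 hn)]
  | minBased =>
    dsimp only
    split_ifs with hF
    · obtain ⟨f, _, hf⟩ := exists_mem_eq_inf' hF (g.value Γ)
      obtain ⟨f', _, hf'⟩ := exists_mem_eq_inf' hF (g.value Δ)
      have h₁ := value_bounds Γ f
      have h₂ := value_bounds Δ f'
      rw [hf, hf', abs_lt]
      constructor <;> nlinarith
    · simpa using pow_pos (by omega : (0 : ℤ) < g.n) 3

/-- A nonzero integer `x` contributes at least `M ≥ K > |y|` in absolute value and decides the sign.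
-/
theorem lexicographic {M : ℝ} {K x y : ℤ} (hM : (K : ℝ) ≤ M) (hy : |y| < K) :
    0 < M * x + y ↔ 0 < x ∨ x = 0 ∧ 0 < y := by
  have hK : (0 : ℤ) < K := (abs_nonneg y).trans_lt hy
  have hM0 : (0 : ℝ) < M := lt_of_lt_of_le (by exact_mod_cast hK) hM
  have h₁ : (y : ℝ) < M := lt_of_lt_of_le (by exact_mod_cast (abs_lt.1 hy).2) hM
  have h₂ : -M < (y : ℝ) := by
    have : -(K : ℝ) < y := by exact_mod_cast (abs_lt.1 hy).1
    linarith
  rcases lt_trichotomy x 0 with hx | rfl | hx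
  · have : (x : ℝ) ≤ -1 := by exact_mod_cast Int.le_sub_one_of_lt hx
    exact iff_of_false (by nlinarith) (by omega)
  · simp
  · have : (1 : ℝ) ≤ x := by exact_mod_cast hx
    exact iff_of_true (by nlinarith) (by omega)

/-- `Improves` expresses the preferences of the agents. -/
theorem improves_iff {M : ℝ} (hM : (g.n : ℝ) ^ 3 ≤ M)
    (hA : ∀ i j : Fin g.n, A i j ↔ g.network.Adj i j)
    (hP : ∀ i j : Fin g.n, P i j ↔ j ∈ Γ.part i) (hQ : ∀ i j : Fin g.n, Q i j ↔ j ∈ Δ.part i)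
    {N : ℕ} (hN : g.n * g.n ≤ N) (i : Fin g.n) :
    Improves g.aggregation g.altruism N g.n A P Q i ↔ ¬ g.WeaklyPrefers M i Γ Δ := by
  have hv : (natValue g.n A Q i : ℤ) - natValue g.n A P i = g.value Δ i - g.value Γ i := by
    rw [natValue_eq hA hP, natValue_eq hA hQ]; ring
  have ha := natAggregate_sub hA hP hQ hN (S := A i) (F := g.friends i)
    fun f => by rw [mem_friends, hA]
  have ha' := natAggregate_sub hA hP hQ hN (S := fun f => A i f ∨ f = i) (F := g.friends i ∪ {i})
    fun f => by rw [mem_union, mem_friends, hA, mem_singleton, Fin.ext_iff]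
  have hM' : (((g.n : ℤ) ^ 3 : ℤ) : ℝ) ≤ M := by exact_mod_cast hM
  have hb := abs_aggregate_sub_lt Γ Δ i
  -- In the altruistic model the agent's own value is the unweighted term, so it needs the bound.
  have hc : |g.value Δ i - g.value Γ i| < (g.n : ℤ) ^ 3 := by
    have hn : (1 : ℤ) ≤ g.n := by exact_mod_cast i.pos
    have hn2 : (g.n : ℤ) ^ 2 ≤ (g.n : ℤ) ^ 3 := pow_le_pow_right₀ hn (by norm_num)
    have := abs_value_sub_le Γ Δ i
    omega
  unfold Improves WeaklyPrefers utility
  rw [ge_iff_le, not_le]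
  cases g.altruism with
  | selfishFirst =>
    dsimp only
    rw [← sub_pos (α := ℝ), show M * (g.value Δ i : ℝ) + (g.aggregate Δ (g.friends i) : ℝ) -
      (M * (g.value Γ i : ℝ) + (g.aggregate Γ (g.friends i) : ℝ)) =
      M * ((g.value Δ i - g.value Γ i : ℤ) : ℝ) +
        ((g.aggregate Δ (g.friends i) - g.aggregate Γ (g.friends i) : ℤ) : ℝ) by
        push_cast; ring, lexicographic hM' hb]
    omega
  | equalTreatment =>
    dsimp only
    rw [Int.cast_lt]
    omega
  | altruisticTreatment =>
    dsimp only
    rw [← sub_pos (α := ℝ), show (g.value Δ i : ℝ) + M * (g.aggregate Δ (g.friends i) : ℝ) -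
      ((g.value Γ i : ℝ) + M * (g.aggregate Γ (g.friends i) : ℝ)) =
      M * ((g.aggregate Δ (g.friends i) - g.aggregate Γ (g.friends i) : ℤ) : ℝ) +
        ((g.value Δ i - g.value Γ i : ℤ) : ℝ) by
        push_cast; ring, lexicographic hM' hc]
    omega

end ACFG

/-! ### Definability of preferences and of partitions. -/

namespace ACFG

open Finset

/-- A family of relations on positions, depending on a word and on the number of agents, is
definable. -/
def DefinableRel {Γ : Type} (R : List Γ → ℕ → ℕ → ℕ → Prop) : Prop :=
  ∀ {d : ℕ} (n i j : Fin d), DefinablePred d fun W e => R W (e n) (e i) (e j)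

variable {Γ : Type} {A P Q : List Γ → ℕ → ℕ → ℕ → Prop} {d : ℕ}

theorem definable_natValue (hA : DefinableRel A) (hP : DefinableRel P) (n i : Fin d) :
    Definable d fun W e => natValue (e n) (A W (e n)) (P W (e n)) (e i) := by
  classical
  refine ((Definable.var n).mul (Definable.sum_range n (f := fun W e j =>
    if P W (e n) (e i) j ∧ A W (e n) (e i) j then 1 else 0) ?_)).add
    (Definable.sum_range n (f := fun W e j =>
    if ¬ (P W (e n) (e i) j ∧ ¬ A W (e n) (e i) j ∧ j ≠ e i) then 1 else 0) ?_) |>.congr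
      fun W e _ => ?_
  · exact ((hP n.castSucc i.castSucc (Fin.last d)).and
      (hA n.castSucc i.castSucc (Fin.last d))).indicator
  · exact ((hP n.castSucc i.castSucc (Fin.last d)).and
      ((hA n.castSucc i.castSucc (Fin.last d)).not.and
        (DefinablePred.eq (.var (Fin.last d)) (.var i.castSucc)).not)).not.indicator
  · unfold natValue
    congr!

theorem definable_natAggregate (hA : DefinableRel A) (hP : DefinableRel P) (a : Aggregation)
    (n i : Fin d) {S : List Γ → ℕ → ℕ → ℕ → Prop} (hS : DefinableRel S) :
    Definable d fun W e =>
      natAggregate a W.length (e n) (A W (e n)) (P W (e n)) (S W (e n) (e i)) := by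
  classical
  cases a with
  | sumBased =>
    refine (Definable.sum_range n (f := fun W e f => if S W (e n) (e i) f then
      natValue (e n) (A W (e n)) (P W (e n)) f else 0) ?_).congr fun W e _ => ?_
    · exact (Definable.ite (hS n.castSucc i.castSucc (Fin.last d))
        (definable_natValue hA hP n.castSucc (Fin.last d)) (.const 0)).congr
          fun _ _ _ => by congr!
    · unfold natAggregate
      congr!
  | minBased =>
    refine (Definable.sum_range_length (f := fun W e k => if ∀ f < e n, S W (e n) (e i) f →
      k < natValue (e n) (A W (e n)) (P W (e n)) f then 1 else 0) ?_).congr fun W e _ => ?_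
    · exact (DefinablePred.forall_lt n.castSucc (p := fun W e f =>
        S W (e n.castSucc) (e i.castSucc) f → e (Fin.last d) <
          natValue (e n.castSucc) (A W (e n.castSucc)) (P W (e n.castSucc)) f)
        ((hS n.castSucc.castSucc i.castSucc.castSucc (Fin.last _)).imp
          (.lt (.var (Fin.last d).castSucc) (definable_natValue hA hP n.castSucc.castSucc
            (Fin.last _))))).indicator
    · unfold natAggregate
      congr!

theorem definable_improves (hA : DefinableRel A) (hP : DefinableRel P) (hQ : DefinableRel Q)
    (a : Aggregation) (c : Altruism) (n i : Fin d) :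
    DefinablePred d fun W e =>
      Improves a c W.length (e n) (A W (e n)) (P W (e n)) (Q W (e n)) (e i) := by
  have hS : DefinableRel fun W n i f => A W n i f ∨ f = i :=
    fun n i f => (hA n i f).or (.eq (.var f) (.var i))
  cases c with
  | selfishFirst =>
    exact .or (.lt (definable_natValue hA hP n i) (definable_natValue hA hQ n i))
      (.and (.eq (definable_natValue hA hP n i) (definable_natValue hA hQ n i))
        (.lt (definable_natAggregate hA hP a n i hA) (definable_natAggregate hA hQ a n i hA)))
  | equalTreatment =>
    exact .lt (definable_natAggregate hA hP a n i (S := fun W n i f => A W n i f ∨ f = i) hS)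
      (definable_natAggregate hA hQ a n i (S := fun W n i f => A W n i f ∨ f = i) hS)
  | altruisticTreatment =>
    exact .or (.lt (definable_natAggregate hA hP a n i hA) (definable_natAggregate hA hQ a n i hA))
      (.and (.eq (definable_natAggregate hA hP a n i hA) (definable_natAggregate hA hQ a n i hA))
        (.lt (definable_natValue hA hP n i) (definable_natValue hA hQ n i)))

/-- The relation that holds between the indices of equal rows of a matrix. -/
def SameRow (n : ℕ) (B : ℕ → ℕ → Prop) (i j : ℕ) : Prop := ∀ k < n, B i k ↔ B j k

/-- A relation on the numbers below `n` is an equivalence relation: it relates exactly the indices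
of equal rows of its matrix. -/
def IsPartition (n : ℕ) (P : ℕ → ℕ → Prop) : Prop := ∀ i < n, ∀ j < n, P i j ↔ SameRow n P i j

theorem definableRel_sameRow (hP : DefinableRel P) : DefinableRel fun W n => SameRow n (P W n) :=
  fun {d} n i j => DefinablePred.forall_lt n
    (p := fun W e k => P W (e n) (e i) k ↔ P W (e n) (e j) k)
    ((hP n.castSucc i.castSucc (Fin.last d)).iff (hP n.castSucc j.castSucc (Fin.last d)))

theorem definable_isPartition (hP : DefinableRel P) (n : Fin d) :
    DefinablePred d fun W e => IsPartition (e n) (P W (e n)) :=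
  DefinablePred.forall_lt n (DefinablePred.forall_lt n.castSucc
    (p := fun W e j => P W (e n.castSucc) (e (Fin.last d)) j ↔
      SameRow (e n.castSucc) (P W (e n.castSucc)) (e (Fin.last d)) j)
    ((hP n.castSucc.castSucc (Fin.last d).castSucc (Fin.last _)).iff
      (definableRel_sameRow hP n.castSucc.castSucc (Fin.last d).castSucc (Fin.last _))))

/-! ### Reading words -/

/-- The word `l` is found from position `o` on. -/
def Reads {α : Type} (s : ℕ → Option α) (o : ℕ) (l : List α) : Prop :=
  ∀ t < l.length, s (o + t) = l[t]?

/-- The entry in row `i` and column `j` of the matrix with `n` columns that starts at position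
`o`. -/
def Entry (s : ℕ → Option Symbol) (o n i j : ℕ) : Prop :=
  s (o + (i * (n + 1) + j)) = some (.bit true)

/-- An `n` by `n` matrix starts at position `o`. -/
def IsMatrix (s : ℕ → Option Symbol) (o n : ℕ) : Prop :=
  ∀ i < n, s (o + (i * (n + 1) + n)) = some .comma ∧
    ∀ j < n, Entry s o n i j ∨ s (o + (i * (n + 1) + j)) = some (.bit false)

theorem getElem?_flatten_of_length {α : Type} {m : ℕ} {L : List (List α)}
    (hL : ∀ l ∈ L, l.length = m) {i j : ℕ} (hj : j < m) :
    L.flatten[i * m + j]? = L[i]?.bind fun l => l[j]? := by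
  induction L generalizing i with
  | nil => simp
  | cons l L ih =>
    have hl : l.length = m := hL l (by simp)
    cases i with
    | zero => simp [List.getElem?_append_left (show j < l.length by omega)]
    | succ i =>
      rw [List.flatten_cons, List.getElem?_append_right (by rw [hl, Nat.succ_mul]; omega),
        show (i + 1) * m + j - l.length = i * m + j by rw [hl, Nat.succ_mul]; omega,
        ih fun l' hl' => hL l' (by simp [hl'])]
      simp

theorem getElem?_encodeRel {n : ℕ} (R : Fin n → Fin n → Prop) (i : Fin n) {j : ℕ}
    (hj : j < n + 1) : open scoped Classical in
    (encodeRel R)[i * (n + 1) + j]? =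
      some (if h : j < n then .bit (decide (R i ⟨j, h⟩)) else .comma) := by
  classical
  unfold encodeRel
  rw [getElem?_flatten_of_length (m := n + 1) (by simp) hj]
  simp only [List.getElem?_ofFn, i.2, dif_pos, Option.bind_some, Fin.eta]
  by_cases h : j < n
  · rw [List.getElem?_append_left (by simpa using h)]
    simp [h]
  · obtain rfl : j = n := by omega
    rw [List.getElem?_append_right (by simp)]
    simp

theorem exists_row {n t : ℕ} (ht : t < n * (n + 1)) :
    ∃ i < n, ∃ j < n + 1, t = i * (n + 1) + j :=
  ⟨t / (n + 1), Nat.div_lt_of_lt_mul (by rwa [mul_comm] at ht), t % (n + 1),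
    Nat.mod_lt _ (by omega), by rw [mul_comm]; exact (Nat.div_add_mod t (n + 1)).symm⟩

theorem reads_encodeRel_iff {s : ℕ → Option Symbol} {o n : ℕ} {R : Fin n → Fin n → Prop} :
    Reads s o (encodeRel R) ↔ IsMatrix s o n ∧ ∀ i j : Fin n, Entry s o n i j ↔ R i j := by
  classical
  unfold Reads
  rw [length_encodeRel]
  constructor
  · intro h
    have h' : ∀ (i : Fin n) (j : ℕ) (hj : j < n + 1), s (o + (i * (n + 1) + j)) =
        some (if h : j < n then .bit (decide (R i ⟨j, h⟩)) else .comma) := fun i j hj => by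
      rw [h _ ?_, getElem?_encodeRel R i hj]
      have := Nat.mul_le_mul_right (n + 1) (Nat.succ_le_of_lt i.2)
      rw [Nat.succ_mul] at this
      omega
    refine ⟨fun i hi => ⟨?_, fun j hj => ?_⟩, fun i j => ?_⟩
    · rw [h' ⟨i, hi⟩ n (by omega)]
      simp
    · rw [Entry, h' ⟨i, hi⟩ j (by omega), dif_pos hj]
      by_cases hr : R ⟨i, hi⟩ ⟨j, hj⟩ <;> simp [hr]
    · rw [Entry, h' i j (by omega), dif_pos j.2]
      simp
  · rintro ⟨h, hR⟩ t ht
    obtain ⟨i, hi, j, hj, rfl⟩ := exists_row ht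
    rw [getElem?_encodeRel R ⟨i, hi⟩ hj]
    by_cases hjn : j < n
    · rw [dif_pos hjn]
      have := hR ⟨i, hi⟩ ⟨j, hjn⟩
      by_cases hr : R ⟨i, hi⟩ ⟨j, hjn⟩
      · rw [show s _ = _ from this.2 hr]
        simp [hr]
      · have h₁ := ((h i hi).2 j hjn).resolve_left fun h' => hr (this.1 h')
        simpa [hr] using h₁
    · obtain rfl : j = n := by omega
      simpa using (h i hi).1

end ACFG

/-! ### Perfect structures in the sum-based equal treatment model. -/

namespace ACFG

open Finset Function

section Coloring

open scoped Classical

variable {V : Type} [Fintype V] (G : SimpleGraph V)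

/-- The value of `x` for `f`. -/
noncomputable def weight (f x : V) : ℤ :=
  if G.Adj f x then Fintype.card V else if x = f then 0 else -1

/-- The value of agent `f` if the coalitions are the fibres of `c`. -/
noncomputable def fibreValue {κ : Type} (c : V → κ) (f : V) : ℤ :=
  ∑ x, if c f = c x then weight G f x else 0

variable {G}

theorem weight_comm (f x : V) : weight G f x = weight G x f := by
  simp only [weight, G.adj_comm f x, eq_comm (a := x)]

theorem neg_one_le_weight (f x : V) : -1 ≤ weight G f x := by
  unfold weight; split_ifs <;> omega

/-- One friend contributes `|V|`, and the fewer than `|V|` other members of `S` cost at most one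
each. -/
theorem sum_weight_pos {f : V} {S : Finset V} {x : V} (hx : x ∈ S) (h : G.Adj f x) :
    0 < ∑ x ∈ S, weight G f x := by
  rw [← add_sum_erase S _ hx]
  have h₁ : (S.erase x).card • (-1 : ℤ) ≤ ∑ y ∈ S.erase x, weight G f y :=
    card_nsmul_le_sum _ _ _ fun y _ => neg_one_le_weight f y
  have h₂ : ((S.erase x).card : ℤ) < Fintype.card V := by
    exact_mod_cast (card_erase_lt_of_mem hx).trans_le (card_le_univ S)
  have h₃ : weight G f x = Fintype.card V := if_pos h
  rw [nsmul_eq_mul] at h₁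
  omega

/-- The coalitions in which no agent prefers other coalitions, for the sum-based equal treatment
model. -/
def FibresPerfect (G : SimpleGraph V) {κ : Type} (c : V → κ) : Prop :=
  ∀ (i : V) (κ' : Type) (c' : V → κ'),
    ∑ f with G.Adj i f ∨ f = i, fibreValue G c' f ≤ ∑ f with G.Adj i f ∨ f = i, fibreValue G c f

variable {κ : Type} {c : V → κ}

theorem FibresPerfect.not_le_of_lt (h : FibresPerfect G c) {i : V} {κ' : Type} {c' : V → κ'}
    (hle : ∀ f, G.Adj i f ∨ f = i → fibreValue G c f ≤ fibreValue G c' f) :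
    ¬ fibreValue G c i < fibreValue G c' i := fun hlt =>
  (h i κ' c').not_gt (sum_lt_sum (fun f hf => hle f (by simpa using hf)) ⟨i, by simp, hlt⟩)

/-- A friend `k` in the same coalition as `i` has a friend in every coalition in which `i` has a
friend. -/
theorem FibresPerfect.exists_adj (h : FibresPerfect G c) {i j k : V} (hij : G.Adj i j)
    (hc : c i ≠ c j) (hik : G.Adj i k) (hck : c k = c i) : ∃ x, G.Adj k x ∧ c x = c j := by
  by_contra! hk
  -- Let `j` move to the coalition of `i`. Nobody around `k` is left behind by `j`, so only members
  -- of the coalition of `i` are affected, each by its weight for `j`.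
  have key : ∀ f, G.Adj k f ∨ f = k → fibreValue G (update c j (c i)) f =
      fibreValue G c f + if c f = c i then weight G j f else 0 := by
    intro f hf
    have hfj : c f ≠ c j := by
      rcases hf with hf | rfl
      · exact hk f hf
      · rwa [hck]
    have hne : f ≠ j := fun h => hfj (by rw [h])
    have : (if c f = c i then weight G j f else 0) =
        ∑ x, if x = j then if c f = c i then weight G j f else 0 else 0 := by simp
    rw [this, fibreValue, fibreValue, ← sum_add_distrib]
    refine sum_congr rfl fun x _ => ?_
    rw [update_of_ne hne]
    rcases eq_or_ne x j with rfl | hx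
    · rw [update_self, if_neg hfj, zero_add, if_pos rfl, weight_comm]
    · rw [update_of_ne hx, if_neg hx, add_zero]
  have hle := h k κ (update c j (c i))
  rw [sum_congr rfl fun f hf => key f (by simpa using hf), sum_add_distrib, ← sum_filter] at hle
  -- By symmetry of the weights the total change is what `j` assigns to these members. It is
  -- positive because `i` is among them.
  have := sum_weight_pos (G := G) (f := j) (x := i)
    (S := (univ.filter fun f => G.Adj k f ∨ f = k).filter fun f => c f = c i)
    (by simp [hik.symm]) hij.symm
  omega

/-- Merge the two coalitions. Friends of `i` in its own coalition gain a friend by `exists_adj`,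
friends of `i` in the other one gain `i`, and the rest are unaffected. As `i` gains `j`, the merger
contradicts perfection. -/
theorem FibresPerfect.eq_of_adj (h : FibresPerfect G c) {i j : V} (hij : G.Adj i j) :
    c i = c j := by
  by_contra hc
  let c' : V → κ := fun f => if c f = c j then c i else c f
  have h₁ : ∀ f, c f = c i →
      fibreValue G c' f = fibreValue G c f + ∑ x with c x = c j, weight G f x := by
    intro f hf
    rw [sum_filter, fibreValue, fibreValue, ← sum_add_distrib]
    refine sum_congr rfl fun x _ => ?_
    simp only [c', hf, if_neg hc]
    by_cases hx : c x = c j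
    · simp [hx, hc]
    · simp [hx]
  have h₂ : ∀ f, c f = c j →
      fibreValue G c' f = fibreValue G c f + ∑ x with c x = c i, weight G f x := by
    intro f hf
    rw [sum_filter, fibreValue, fibreValue, ← sum_add_distrib]
    refine sum_congr rfl fun x _ => ?_
    simp only [c', hf, if_true]
    by_cases hx : c x = c j
    · simp [hx, Ne.symm hc]
    · simp [hx, Ne.symm hx, eq_comm (a := c i)]
  have h₃ : ∀ f, c f ≠ c i → c f ≠ c j → fibreValue G c' f = fibreValue G c f := by
    intro f hi hj
    refine sum_congr rfl fun x _ => ?_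
    simp only [c', if_neg hj]
    by_cases hx : c x = c j
    · simp [hx, hi, hj]
    · simp [hx]
  refine h.not_le_of_lt (i := i) (c' := c') (fun f hf => ?_) ?_
  · by_cases hfi : c f = c i
    · obtain ⟨x, hx, hxj⟩ : ∃ x, G.Adj f x ∧ c x = c j := by
        rcases hf with hf | rfl
        · exact h.exists_adj hij hc hf hfi
        · exact ⟨j, hij, rfl⟩
      have := sum_weight_pos (S := univ.filter fun x => c x = c j) (by simpa using hxj) hx
      rw [h₁ f hfi]
      omega
    by_cases hfj : c f = c j
    · have hf' : G.Adj i f := hf.resolve_right fun h => hfi (by rw [h])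
      have := sum_weight_pos (S := univ.filter fun x => c x = c i) (x := i) (by simp) hf'.symm
      rw [h₂ f hfj]
      omega
    · exact (h₃ f hfi hfj).ge
  · have := sum_weight_pos (S := univ.filter fun x => c x = c j) (x := j) (by simp) hij
    rw [h₁ i rfl]
    omega

/-- If `j` is neither `i`, nor a friend, nor a friend of a friend, then `j` is an enemy of `i` and
of all friends of `i`. Isolating `j` harms none of them and strictly helps `i`. -/
theorem FibresPerfect.exists_path (h : FibresPerfect G c) {i j : V} (hc : c i = c j) :
    j = i ∨ G.Adj i j ∨ ∃ k, G.Adj i k ∧ G.Adj k j := by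
  by_contra! hn
  obtain ⟨hne, hij, hk⟩ := hn
  -- The value `none` is a fresh colour that puts `j` into a coalition of its own.
  let c' : V → Option κ := fun f => if f = j then none else some (c f)
  have key : ∀ f, G.Adj i f ∨ f = i →
      fibreValue G c' f = fibreValue G c f + if c f = c j then 1 else 0 := by
    intro f hf
    have hfj : f ≠ j := by
      rintro rfl
      rcases hf with hf | hf
      · exact hij hf
      · exact hne hf
    have hadj : ¬ G.Adj f j := by
      rcases hf with hf | rfl
      · exact hk f hf
      · exact hij
    have : (if c f = c j then 1 else 0 : ℤ) =
        ∑ x, if x = j then if c f = c j then 1 else 0 else 0 := by simp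
    rw [this, fibreValue, fibreValue, ← sum_add_distrib]
    refine sum_congr rfl fun x _ => ?_
    rcases eq_or_ne x j with rfl | hx
    · by_cases hcf : c f = c x <;> simp [c', hfj, hcf, weight, hadj, Ne.symm hfj]
    · simp [c', hfj, hx]
  refine h.not_le_of_lt (i := i) (c' := c') (fun f hf => ?_) ?_
  · rw [key f hf]
    split_ifs <;> omega
  · rw [key i (Or.inr rfl), if_pos hc]
    omega

end Coloring

/-- Deviations are described by colourings, which are easier to modify than partitions; this turns
them back into coalition structures. -/
theorem exists_coalitionStructure (n : ℕ) {κ : Type} (c : Fin n → κ) :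
    ∃ Δ : Finpartition (univ : Finset (Fin n)), ∀ i j, j ∈ Δ.part i ↔ c i = c j := by
  classical
  refine ⟨Finpartition.ofSetoid (Setoid.ker c), fun i j => ?_⟩
  rw [Finpartition.mem_part_ofSetoid_iff_rel]
  rfl

variable {g : ACFG} {Γ : g.CoalitionStructure}

theorem value_eq_fibreValue {κ : Type} {c : Fin g.n → κ} (h : ∀ i j, j ∈ Γ.part i ↔ c i = c j)
    (f : Fin g.n) : g.value Γ f = fibreValue g.network c f := by
  classical
  have h₁ : (univ.filter fun x => c f = c x) = Γ.part f := by ext x; simp [h]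
  have h₂ : ∀ x, weight g.network f x =
      (if x ∈ g.friends f then (g.n : ℤ) else 0) - if x ∈ g.enemies f then 1 else 0 := fun x => by
    by_cases hx : g.network.Adj f x
    · simp [weight, mem_friends, mem_enemies, hx]
    · by_cases hxf : x = f <;> simp [weight, mem_friends, mem_enemies, hx, hxf]
  rw [fibreValue, ← sum_filter, h₁, sum_congr rfl fun x _ => h₂ x, sum_sub_distrib, sum_ite_mem,
    sum_ite_mem, sum_const, sum_const, nsmul_eq_mul, nsmul_eq_mul, mul_one, mul_comm, value]

/-- In the sum-based equal treatment model, a perfect coalition structure consists of the agents at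
distance at most two. -/
theorem IsPerfect.mem_part_iff {M : ℝ} (ha : g.aggregation = .sumBased)
    (hd : g.altruism = .equalTreatment) (h : g.IsPerfect M Γ) (i j : Fin g.n) :
    j ∈ Γ.part i ↔
      j = i ∨ g.network.Adj i j ∨ ∃ k, g.network.Adj i k ∧ g.network.Adj k j := by
  classical
  have hc : ∀ i j, j ∈ Γ.part i ↔ Γ.part i = Γ.part j := fun i j =>
    ⟨fun h => (Γ.part_eq_of_mem (Γ.part_mem.2 (mem_univ i)) h).symm,
      fun h => h ▸ Γ.mem_part (mem_univ j)⟩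
  have hp : FibresPerfect g.network Γ.part := by
    intro i κ' c'
    obtain ⟨Δ, hΔ⟩ := exists_coalitionStructure g.n c'
    have := h i Δ
    simp only [WeaklyPrefers, utility, aggregate, ha, hd, ge_iff_le, Int.cast_le] at this
    have hN : g.friends i ∪ {i} = univ.filter fun f => g.network.Adj i f ∨ f = i := by
      ext f; simp [mem_friends, or_comm]
    rw [hN] at this
    simp only [value_eq_fibreValue hΔ, value_eq_fibreValue hc] at this
    convert this
  constructor
  · intro hj
    exact hp.exists_path ((hc i j).1 hj)
  · rintro (rfl | hij | ⟨k, hik, hkj⟩)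
    · exact Γ.mem_part (mem_univ j)
    · exact (hc i j).2 (hp.eq_of_adj hij)
    · exact (hc i j).2 ((hp.eq_of_adj hik).trans (hp.eq_of_adj hkj))

end ACFG

/-! ### Recognizing instances inside a word with a certificate. -/

namespace ACFG

variable {d : ℕ}

/-- The symbol of the input at position `t`, for an input followed by a certificate. -/
def inputSymbol (W : List (Symbol ⊕ Bool)) (t : ℕ) : Option Symbol := W[t]?.bind Sum.getLeft?

/-- The two alphabets are disjoint, so the certificate looks like the end of the input. -/
theorem inputSymbol_append (x : List Symbol) (w : List Bool) :
    inputSymbol (x.map .inl ++ w.map .inr) = fun t => x[t]? := by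
  funext t
  unfold inputSymbol
  rcases lt_or_ge t x.length with h | h
  · rw [List.getElem?_append_left (by simpa using h)]
    simp [h]
  · rw [List.getElem?_append_right (by simpa using h), List.getElem?_eq_none h]
    cases h' : w[t - x.length]? <;> simp [h']

/-- A function of the number of agents is definable. -/
def DefinableFun (o : ℕ → ℕ) : Prop :=
  ∀ {d : ℕ} (n : Fin d), Definable (Γ := Symbol ⊕ Bool) d fun _ e => o (e n)

theorem definable_inputSymbol {f : List (Symbol ⊕ Bool) → (Fin d → ℕ) → ℕ} (hf : Definable d f)
    (c : Symbol) : DefinablePred d fun W e => inputSymbol W (f W e) = some c :=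
  (DefinablePred.any_getElem? hf fun a => decide (a = .inl c)).of_iff fun W e => by
    unfold inputSymbol
    rcases W[f W e]? with - | (a | a) <;> simp

theorem definable_isSome_inputSymbol {f : List (Symbol ⊕ Bool) → (Fin d → ℕ) → ℕ}
    (hf : Definable d f) : DefinablePred d fun W e => (inputSymbol W (f W e)).isSome :=
  (DefinablePred.any_getElem? hf Sum.isLeft).of_iff fun W e => by
    unfold inputSymbol
    rcases W[f W e]? with - | (a | a) <;> simp

theorem definableRel_entry {o : ℕ → ℕ} (ho : DefinableFun o) :
    DefinableRel fun W n => Entry (inputSymbol W) (o n) n := fun n i j =>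
  definable_inputSymbol ((ho n).add (((Definable.var i).mul
    ((Definable.var n).add (.const 1))).add (.var j))) _

theorem definable_isMatrix {o : ℕ → ℕ} (ho : DefinableFun o) (n : Fin d) :
    DefinablePred d fun W e => IsMatrix (inputSymbol W) (o (e n)) (e n) := by
  have ht : ∀ {d} (n i j : Fin d), Definable (Γ := Symbol ⊕ Bool) d fun _ e =>
      o (e n) + (e i * (e n + 1) + e j) := fun n i j =>
    (ho n).add (((Definable.var i).mul ((Definable.var n).add (.const 1))).add (.var j))
  refine DefinablePred.forall_lt n (p := fun W e i =>
    inputSymbol W (o (e n) + (i * (e n + 1) + e n)) = some .comma ∧ ∀ j < e n,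
      Entry (inputSymbol W) (o (e n)) (e n) i j ∨
        inputSymbol W (o (e n) + (i * (e n + 1) + j)) = some (.bit false)) ?_
  refine (definable_inputSymbol (ht n.castSucc (Fin.last d) n.castSucc) _).and ?_
  exact DefinablePred.forall_lt n.castSucc (p := fun W e j =>
      Entry (inputSymbol W) (o (e n.castSucc)) (e n.castSucc) (e (Fin.last d)) j ∨
        inputSymbol W (o (e n.castSucc) + (e (Fin.last d) * (e n.castSucc + 1) + j)) =
          some (.bit false))
    ((definableRel_entry ho n.castSucc.castSucc (Fin.last d).castSucc (Fin.last _)).or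
      (definable_inputSymbol (ht n.castSucc.castSucc (Fin.last d).castSucc (Fin.last _)) _))

/-- A word that starts with a game with `n` agents, of a kind in `T`. -/
def IsGame (T : Set (Aggregation × Altruism)) (s : ℕ → Option Symbol) (n : ℕ) : Prop :=
  (∃ k : Aggregation × Altruism, k ∈ T ∧ s 0 = some (.kind k.1 k.2)) ∧ IsMatrix s 1 n ∧
    (∀ i < n, ¬ Entry s 1 n i i) ∧ ∀ i < n, ∀ j < n, Entry s 1 n i j → Entry s 1 n j i

theorem definable_isGame (T : Set (Aggregation × Altruism)) (n : Fin d) :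
    DefinablePred d fun W e => IsGame T (inputSymbol W) (e n) := by
  have h₁ : DefinableFun fun _ => 1 := fun _ => .const 1
  have hE : DefinableRel fun W n => Entry (inputSymbol W) 1 n :=
    definableRel_entry (o := fun _ => 1) h₁
  refine (DefinablePred.exists_fintype fun k => ?_).and
    ((definable_isMatrix (o := fun _ => 1) h₁ n).and
    (.and (DefinablePred.forall_lt n (p := fun W e i => ¬ Entry (inputSymbol W) 1 (e n) i i) ?_)
      (DefinablePred.forall_lt n (p := fun W e i => ∀ j < e n,
        Entry (inputSymbol W) 1 (e n) i j → Entry (inputSymbol W) 1 (e n) j i) ?_)))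
  · by_cases hk : k ∈ T
    · exact (definable_inputSymbol (.const 0) _).of_iff fun _ _ => and_iff_right hk
    · exact DefinablePred.false.of_iff fun _ _ => by simp [hk]
  · exact (hE n.castSucc (Fin.last d) (Fin.last d)).not
  · exact DefinablePred.forall_lt n.castSucc (p := fun W e j =>
      Entry (inputSymbol W) 1 (e n.castSucc) (e (Fin.last d)) j →
        Entry (inputSymbol W) 1 (e n.castSucc) j (e (Fin.last d)))
      ((hE n.castSucc.castSucc (Fin.last d).castSucc (Fin.last _)).imp
        (hE n.castSucc.castSucc (Fin.last _) (Fin.last d).castSucc))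

theorem reads_cons {α : Type} {s : ℕ → Option α} {o : ℕ} {a : α} {l : List α} :
    Reads s o (a :: l) ↔ s o = some a ∧ Reads s (o + 1) l := by
  constructor
  · intro h
    refine ⟨by simpa using h 0 (by simp), fun t ht => ?_⟩
    have := h (t + 1) (by simpa using ht)
    rwa [List.getElem?_cons_succ, ← add_assoc, add_right_comm] at this
  · rintro ⟨h₁, h₂⟩ (_ | t) ht
    · simpa using h₁
    · rw [List.getElem?_cons_succ, ← add_assoc, add_right_comm]
      exact h₂ t (by simpa using ht)

theorem reads_append {α : Type} {s : ℕ → Option α} {o : ℕ} {l l' : List α} :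
    Reads s o (l ++ l') ↔ Reads s o l ∧ Reads s (o + l.length) l' := by
  induction l generalizing o with
  | nil => simp [Reads]
  | cons a l ih =>
    rw [List.cons_append, reads_cons, reads_cons, ih, and_assoc, List.length_cons, add_assoc o 1,
      add_comm 1]

theorem eq_iff_reads {α : Type} {x l : List α} :
    x = l ↔ x.length = l.length ∧ Reads (fun t => x[t]?) 0 l := by
  constructor
  · rintro rfl
    exact ⟨rfl, fun t _ => by simp⟩
  · rintro ⟨h, hr⟩
    refine List.ext_getElem? fun t => ?_
    rcases lt_or_ge t l.length with ht | ht
    · simpa using hr t ht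
    · rw [List.getElem?_eq_none ht, List.getElem?_eq_none (h ▸ ht)]

variable {T : Set (Aggregation × Altruism)} {s : ℕ → Option Symbol} {n : ℕ}

theorem reads_encode_iff {g : ACFG} : Reads s 0 g.encode ↔
    s 0 = some (.kind g.aggregation g.altruism) ∧ IsMatrix s 1 g.n ∧
      ∀ i j : Fin g.n, Entry s 1 g.n i j ↔ g.network.Adj i j := by
  rw [encode, reads_cons, reads_encodeRel_iff]

theorem isGame_of_reads {g : ACFG} (hT : (g.aggregation, g.altruism) ∈ T)
    (h : Reads s 0 g.encode) : IsGame T s g.n := by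
  obtain ⟨h₀, hm, hA⟩ := reads_encode_iff.1 h
  refine ⟨⟨_, hT, h₀⟩, hm, fun i hi h => ?_, fun i hi j hj h => ?_⟩
  · exact g.network.loopless.irrefl ⟨i, hi⟩ ((hA ⟨i, hi⟩ ⟨i, hi⟩).1 h)
  · exact (hA ⟨j, hj⟩ ⟨i, hi⟩).2 ((hA ⟨i, hi⟩ ⟨j, hj⟩).1 h).symm

theorem IsGame.exists_reads (h : IsGame T s n) :
    ∃ (G : SimpleGraph (Fin n)) (a : Aggregation) (d : Altruism), (a, d) ∈ T ∧
      Reads s 0 (ACFG.mk n G a d).encode := by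
  obtain ⟨⟨k, hk, h₀⟩, hm, hi, hs⟩ := h
  exact ⟨⟨fun i j => Entry s 1 n i j, ⟨fun i j => hs i i.2 j j.2⟩, ⟨fun i => hi i i.2⟩⟩, k.1, k.2,
    hk, reads_encode_iff.2 ⟨h₀, hm, fun _ _ => Iff.rfl⟩⟩

/-! ### Coalitions given by matrices -/

theorem sameRow_iff {B : ℕ → ℕ → Prop} {i j : Fin n} :
    SameRow n B i j ↔ (fun k : Fin n => B i k) = fun k : Fin n => B j k :=
  ⟨fun h => funext fun k => propext (h k k.2), fun h k hk => iff_of_eq (congrFun h ⟨k, hk⟩)⟩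

/-- Equality of rows is an equivalence relation for every matrix, so no certificate has to be
rejected as malformed. -/
theorem exists_sameRow (n : ℕ) (B : ℕ → ℕ → Prop) :
    ∃ Δ : Finpartition (Finset.univ : Finset (Fin n)),
      ∀ i j : Fin n, SameRow n B i j ↔ j ∈ Δ.part i := by
  obtain ⟨Δ, h⟩ := exists_coalitionStructure n fun (i k : Fin n) => B i k
  exact ⟨Δ, fun i j => by rw [sameRow_iff, h]⟩

/-- Conversely, the characteristic matrix of a partition gives back that partition, so every
deviation has a certificate. -/
theorem sameRow_iff_mem_part {B : ℕ → ℕ → Prop}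
    {Δ : Finpartition (Finset.univ : Finset (Fin n))}
    (h : ∀ i j : Fin n, B i j ↔ j ∈ Δ.part i) (i j : Fin n) :
    SameRow n B i j ↔ j ∈ Δ.part i := by
  constructor
  · intro hs
    exact (h i j).1 ((hs j j.2).2 ((h j j).2 (Δ.mem_part (Finset.mem_univ j))))
  · intro hj k hk
    rw [h i ⟨k, hk⟩, h j ⟨k, hk⟩, Δ.part_eq_of_mem (Δ.part_mem.2 (Finset.mem_univ i)) hj]

theorem isPartition_iff {P : ℕ → ℕ → Prop} :
    IsPartition n P ↔ ∃ Γ : Finpartition (Finset.univ : Finset (Fin n)),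
      ∀ i j : Fin n, P i j ↔ j ∈ Γ.part i := by
  constructor
  · intro h
    obtain ⟨Γ, hΓ⟩ := exists_sameRow n P
    exact ⟨Γ, fun i j => (h i i.2 j j.2).trans (hΓ i j)⟩
  · rintro ⟨Γ, hΓ⟩ i hi j hj
    exact (hΓ ⟨i, hi⟩ ⟨j, hj⟩).trans (sameRow_iff_mem_part hΓ ⟨i, hi⟩ ⟨j, hj⟩).symm

/-- The word of the bits of a matrix. -/
theorem exists_bits (R : Fin n → Fin n → Prop) : ∃ w : List Bool, w.length = n * n ∧
    ∀ i j : Fin n, w[(j + n * i : ℕ)]? = some true ↔ R i j := by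
  classical
  refine ⟨List.ofFn fun t : Fin (n * n) =>
    decide (R (finProdFinEquiv.symm t).1 (finProdFinEquiv.symm t).2), by simp, fun i j => ?_⟩
  have h : (j + n * i : ℕ) = (finProdFinEquiv (i, j) : Fin (n * n)) := rfl
  rw [h, List.getElem?_ofFn, dif_pos (Fin.is_lt _), Fin.eta, Equiv.symm_apply_apply]
  simp

/-! ### The verifier -/

section Verifier

variable (T) (k : ℕ → ℕ) (C : (ℕ → Option Symbol) → ℕ → Prop)
  (P : (ℕ → Option Symbol) → ℕ → ℕ → ℕ → Prop)

/-- A word of length `k n + 1` that starts with a game with `n` agents, has the property `C`, and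
describes coalitions by `P`. -/
def IsInstance (s : ℕ → Option Symbol) (n : ℕ) : Prop :=
  IsGame T s n ∧ ((s (k n)).isSome ∧ ¬ (s (k n + 1)).isSome) ∧ C s n ∧ IsPartition n (P s n)

/-- The entries of the matrix that is given by the certificate, for an input of length `o`. -/
def CertificateEntry (W : List (Symbol ⊕ Bool)) (o n i j : ℕ) : Prop :=
  W[o + (j + n * i)]?.any (fun a => decide (a = .inr true)) = true

/-- The certificate gives coalitions that some agent prefers to the coalitions of the input. -/
def Accepts (W : List (Symbol ⊕ Bool)) : Prop :=
  ∀ n < W.length, IsInstance T k C P (inputSymbol W) n → ∃ i < n, ∃ c : Aggregation × Altruism,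
    inputSymbol W 0 = some (.kind c.1 c.2) ∧
      Improves c.1 c.2 W.length n (Entry (inputSymbol W) 1 n) (P (inputSymbol W) n)
        (SameRow n (CertificateEntry W (k n + 1) n)) i

variable {T k C P}

theorem definable_accepts (hk : DefinableFun k)
    (hC : ∀ {d} (n : Fin d), DefinablePred d fun W e => C (inputSymbol W) (e n))
    (hP : DefinableRel fun W => P (inputSymbol W)) :
    DefinablePred 0 fun W _ => Accepts T k C P W := by
  refine DefinablePred.forall_lt_length (p := fun W _ n => IsInstance T k C P (inputSymbol W) n →
    ∃ i < n, ∃ c : Aggregation × Altruism, inputSymbol W 0 = some (.kind c.1 c.2) ∧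
      Improves c.1 c.2 W.length n (Entry (inputSymbol W) 1 n) (P (inputSymbol W) n)
        (SameRow n (CertificateEntry W (k n + 1) n)) i) ?_
  have hk₁ : DefinableFun fun n => k n + 1 := fun n => (hk n).add (.const 1)
  refine .imp ((definable_isGame T _).and (((definable_isSome_inputSymbol (hk _)).and
    (definable_isSome_inputSymbol (hk₁ _)).not).and ((hC _).and (definable_isPartition hP _)))) ?_
  refine DefinablePred.exists_lt (Fin.last 0) (p := fun W e i => ∃ c : Aggregation × Altruism,
    inputSymbol W 0 = some (.kind c.1 c.2) ∧
      Improves c.1 c.2 W.length (e (Fin.last 0)) (Entry (inputSymbol W) 1 (e (Fin.last 0)))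
        (P (inputSymbol W) (e (Fin.last 0)))
        (SameRow (e (Fin.last 0)) (CertificateEntry W (k (e (Fin.last 0)) + 1) (e (Fin.last 0)))) i)
    (DefinablePred.exists_fintype fun c => (definable_inputSymbol (.const 0) _).and ?_)
  have hB : DefinableRel fun W n => CertificateEntry W (k n + 1) n := fun n i j =>
    DefinablePred.any_getElem? ((hk₁ n).add ((Definable.var j).add
      ((Definable.var n).mul (.var i)))) _
  have hQ : DefinableRel fun W n => SameRow n (CertificateEntry W (k n + 1) n) :=
    definableRel_sameRow (P := fun W n => CertificateEntry W (k n + 1) n) hB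
  exact definable_improves (definableRel_entry (o := fun _ => 1) fun _ => .const 1) hP
    (Q := fun W n => SameRow n (CertificateEntry W (k n + 1) n)) hQ c.1 c.2
    (Fin.last 0).castSucc (Fin.last 1)

theorem certificateEntry_append (x : List Symbol) (w : List Bool) {o n i j : ℕ}
    (hx : x.length = o) : CertificateEntry (x.map .inl ++ w.map .inr) o n i j ↔
      w[j + n * i]? = some true := by
  subst hx
  unfold CertificateEntry
  rw [List.getElem?_append_right (by simp), List.length_map, Nat.add_sub_cancel_left,
    List.getElem?_map]
  rcases w[j + n * i]? with - | b <;> simp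

/-- Here `k n` is the index of the last symbol of an instance with `n` agents, `C` is a remaining
syntactic condition, and `P` yields the coalitions under test, whether they are written in the input
or computed from it. Words that are not instances are accepted vacuously. -/
theorem inCoNP_of_definable {L : Language Symbol} {M : ACFG → ℝ}
    (hM : ∀ g : ACFG, (g.n : ℝ) ^ 3 ≤ M g) (hk : DefinableFun k) (hki : Function.Injective k)
    (hkn : ∀ n, n * (n + 1) ≤ k n)
    (hC : ∀ {d} (n : Fin d), DefinablePred d fun W e => C (inputSymbol W) (e n))
    (hP : DefinableRel fun W => P (inputSymbol W))
    (hL : ∀ x, x ∈ L ↔ ∃ (g : ACFG) (Γ : g.CoalitionStructure),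
      (g.aggregation, g.altruism) ∈ T ∧ x.length = k g.n + 1 ∧
        Reads (fun t => x[t]?) 0 g.encode ∧ C (fun t => x[t]?) g.n ∧
          (∀ i j : Fin g.n, P (fun t => x[t]?) g.n i j ↔ j ∈ Γ.part i) ∧
            g.IsPerfect (M g) Γ) :
    InCoNP L := by
  have hlen : ∀ (x : List Symbol) (n : ℕ), x.length = n + 1 ↔
      (x[n]?).isSome ∧ ¬ (x[n + 1]?).isSome := fun x n => by
    rw [Option.isSome_iff_ne_none, Option.isSome_iff_ne_none, Ne, Ne, List.getElem?_eq_none_iff,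
      List.getElem?_eq_none_iff]
    omega
  -- The n² bits of a certificate are at most as many as the symbols of the input, by `hkn`.
  refine InNP.of_definablePred Polynomial.X (definable_accepts (T := T) hk hC hP) fun x => ?_
  change x ∉ L ↔ _
  simp only [Polynomial.eval_X, Accepts, inputSymbol_append]
  constructor
  · intro hx
    by_cases h : ∃ n, IsInstance T k C P (fun t => x[t]?) n
    · obtain ⟨n, hg, hn, hc, hp⟩ := h
      rw [← hlen] at hn
      obtain ⟨G, a, d, hT, hr⟩ := hg.exists_reads
      obtain ⟨Γ, hΓ⟩ := isPartition_iff.1 hp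
      have hnot : ¬ IsPerfect ⟨n, G, a, d⟩ (M ⟨n, G, a, d⟩) Γ := fun h' =>
        hx ((hL x).2 ⟨⟨n, G, a, d⟩, Γ, hT, hn, hr, hc, hΓ, h'⟩)
      unfold IsPerfect at hnot
      push Not at hnot
      obtain ⟨i, Δ, hi⟩ := hnot
      obtain ⟨w, hw, hwΔ⟩ := exists_bits fun i j => j ∈ Δ.part i
      replace hw : w.length = n * n := hw
      have hnn : n * n ≤ x.length := by
        have := hkn n
        rw [mul_add] at this
        omega
      refine ⟨w, by omega, fun n' _ hn' => ?_⟩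
      -- The length of the input determines the number of agents.
      obtain rfl : n' = n := hki (by have := (hlen x _).2 hn'.2.1; omega)
      obtain ⟨h₀, -, hA⟩ := reads_encode_iff.1 hr
      refine ⟨i, i.2, (a, d), h₀, ?_⟩
      refine (improves_iff (g := ⟨n', G, a, d⟩) (hM _) hA hΓ
        (sameRow_iff_mem_part fun i j => ?_) ?_ i).2 hi
      · exact (certificateEntry_append x w hn).trans (hwΔ i j)
      · simp only [List.length_append, List.length_map]
        omega
    · exact ⟨[], by simp, fun n _ hn => absurd ⟨n, hn⟩ h⟩
  · rintro ⟨w, -, hw⟩ hx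
    obtain ⟨g, Γ, hT, hn, hr, hc, hΓ, hperf⟩ := (hL x).1 hx
    have hkg := hkn g.n
    have hnn : g.n * g.n ≤ x.length ∧ g.n < x.length := by
      rw [mul_add] at hkg
      constructor <;> nlinarith
    obtain ⟨i, hi, c, h₀', himp⟩ := hw g.n
      (by simp only [List.length_append, List.length_map]; omega)
      ⟨isGame_of_reads hT hr, (hlen _ _).1 hn, hc, isPartition_iff.2 ⟨Γ, hΓ⟩⟩
    obtain ⟨h₀, -, hA⟩ := reads_encode_iff.1 hr
    obtain ⟨h₁, h₂⟩ : g.aggregation = c.1 ∧ g.altruism = c.2 := by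
      simpa using h₀.symm.trans h₀'
    rw [← h₁, ← h₂] at himp
    -- Whatever the certificate is, its equal rows form a structure, which contradicts perfection.
    obtain ⟨Δ, hΔ⟩ := exists_sameRow g.n
      (CertificateEntry (x.map .inl ++ w.map .inr) (k g.n + 1) g.n)
    exact (improves_iff (hM g) hA hΓ hΔ
      (by simp only [List.length_append, List.length_map]; omega) ⟨i, hi⟩).1 himp (hperf _ Δ)

end Verifier

/-! ### The two decision problems. -/

theorem definableFun_mul_succ : DefinableFun fun n => n * (n + 1) := fun n =>
  (Definable.var n).mul ((Definable.var n).add (.const 1))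

theorem strictMono_mul_succ : StrictMono fun n : ℕ => n * (n + 1) :=
  strictMono_nat_of_lt_succ fun n => by nlinarith

theorem inCoNP_perfectnessVerification {M : ACFG → ℝ} (hM : ∀ g : ACFG, (g.n : ℝ) ^ 3 ≤ M g)
    (T : Set (Aggregation × Altruism)) : InCoNP (perfectnessVerification M T) := by
  have ho : DefinableFun fun n => 2 + n * (n + 1) := fun n =>
    (Definable.const 2).add (definableFun_mul_succ n)
  -- Besides two matrices an instance has one kind symbol and one separator; `k` is one less than
  -- the length.
  refine inCoNP_of_definable (T := T) (k := fun n => 1 + (n * (n + 1) + n * (n + 1)))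
    (C := fun s n => s (1 + n * (n + 1)) = some .sep ∧ IsMatrix s (2 + n * (n + 1)) n)
    (P := fun s n => Entry s (2 + n * (n + 1)) n) hM
    (fun n => (Definable.const 1).add ((definableFun_mul_succ n).add (definableFun_mul_succ n)))
    (fun m n h => strictMono_mul_succ.injective (by simp only at h ⊢; omega)) (fun n => by omega)
    (fun n => (definable_inputSymbol ((Definable.const 1).add (definableFun_mul_succ n)) _).and
      (definable_isMatrix (o := fun n => 2 + n * (n + 1)) ho n))
    (definableRel_entry (o := fun n => 2 + n * (n + 1)) ho) fun x => exists₂_congr fun g Γ => ?_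
  have hl : g.encode.length = 1 + g.n * (g.n + 1) := by
    rw [encode, List.length_cons, length_encodeRel, add_comm]
  have hl' : (g.encodeWith Γ).length = 1 + (g.n * (g.n + 1) + g.n * (g.n + 1)) + 1 := by
    rw [encodeWith, List.length_append, List.length_cons, length_encodeRel, hl]
    omega
  rw [eq_iff_reads, hl', encodeWith, reads_append, reads_cons, reads_encodeRel_iff, hl,
    show 0 + (1 + g.n * (g.n + 1)) + 1 = 2 + g.n * (g.n + 1) by omega, Nat.zero_add]
  tauto

/-- The relation of being at distance at most two in the network of friends. -/
theorem definableRel_distance_le_two {o : ℕ → ℕ} (ho : DefinableFun o) :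
    DefinableRel fun W n i j => j = i ∨ Entry (inputSymbol W) (o n) n i j ∨
      ∃ k < n, Entry (inputSymbol W) (o n) n i k ∧ Entry (inputSymbol W) (o n) n k j :=
  fun {d} n i j => (DefinablePred.eq (.var j) (.var i)).or ((definableRel_entry ho n i j).or
    (DefinablePred.exists_lt n (p := fun W e k => Entry (inputSymbol W) (o (e n)) (e n) (e i) k ∧
      Entry (inputSymbol W) (o (e n)) (e n) k (e j))
      ((definableRel_entry ho n.castSucc i.castSucc (Fin.last d)).and
        (definableRel_entry ho n.castSucc (Fin.last d) j.castSucc))))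

/-- The only candidate is the relation of distance at most two, computed from the network. If it is
not a partition, no perfect structure exists and the word is accepted as a non-member. -/
theorem inCoNP_perfectnessExistence {M : ACFG → ℝ} (hM : ∀ g : ACFG, (g.n : ℝ) ^ 3 ≤ M g) :
    InCoNP (perfectnessExistence M {(.sumBased, .equalTreatment)}) := by
  refine inCoNP_of_definable (T := {(.sumBased, .equalTreatment)}) (k := fun n => n * (n + 1))
    (C := fun _ _ => True)
    (P := fun s n i j => j = i ∨ Entry s 1 n i j ∨ ∃ k < n, Entry s 1 n i k ∧ Entry s 1 n k j)
    hM definableFun_mul_succ strictMono_mul_succ.injective (fun n => le_rfl)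
    (fun n => DefinablePred.false.not.of_iff fun _ _ => by simp)
    (definableRel_distance_le_two (o := fun _ => 1) fun _ => .const 1) fun x =>
      exists_congr fun g => ?_
  have hl : g.encode.length = g.n * (g.n + 1) + 1 := by
    rw [encode, List.length_cons, length_encodeRel]
  rw [eq_iff_reads, hl]
  constructor
  · rintro ⟨hT, ⟨hx, hr⟩, Γ, hΓ⟩
    obtain ⟨-, -, hA⟩ := reads_encode_iff.1 hr
    -- Uniqueness enters here: a perfect `Γ` must agree with the computed candidate.
    refine ⟨Γ, hT, hx, hr, trivial, fun i j => ?_, hΓ⟩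
    rw [hΓ.mem_part_iff (Prod.ext_iff.1 hT).1 (Prod.ext_iff.1 hT).2, Fin.ext_iff, hA]
    refine or_congr_right (or_congr_right ⟨?_, ?_⟩)
    · rintro ⟨k, hk, h₁, h₂⟩
      exact ⟨⟨k, hk⟩, (hA _ _).1 h₁, (hA _ _).1 h₂⟩
    · rintro ⟨k, h₁, h₂⟩
      exact ⟨k, k.2, (hA _ _).2 h₁, (hA _ _).2 h₂⟩
  · rintro ⟨Γ, hT, hx, hr, -, -, hΓ⟩
    exact ⟨hT, ⟨hx, hr⟩, Γ, hΓ⟩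

end ACFG

theorem mainTheorem10 (M : ACFG → ℝ) (hM : ∀ g : ACFG, (g.n : ℝ) ^ 3 ≤ M g) :
    (∀ T : Set (Aggregation × Altruism), InCoNP (ACFG.perfectnessVerification M T)) ∧
      InCoNP (ACFG.perfectnessExistence M {(Aggregation.sumBased, Altruism.equalTreatment)}) :=
  ⟨ACFG.inCoNP_perfectnessVerification hM, ACFG.inCoNP_perfectnessExistence hM⟩
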